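/- Let $s>\frac52$ and $\beta\in(0,\infty)$. Let $w_0=(\rho_0,u_0,v_0)\in H^{s-1}(\mathbb R)\times H^s(\mathbb R)\times H^s(\mathbb R)$, let $T\in(0,\infty]$, and let $w=(\rho,u,v)\in C([0,T);H^{s-1}\times H^s\times H^s)$ be a solution on $[0,T)$, with initial data $w_0$, of the 3-component Degasperis–Procesi system $$ \begin{cases} \rho_t+(\rho uv)_x=0,\\ m_t+uv\,m_x+3v u_x m+\rho^2u=0,\\ n_t+uv\,n_x+3u v_x n-\rho^2v=0,\\ m=u-u_{xx},\quad n=v-v_{xx} \end{cases} $$ (for instance, $T$ may be the lifespan of $w$). Suppose that $$ \bigl\|(\rho_0,\rho_{0,x},u_0,u_{0,x},u_{0,xx},v_0,v_{0,x},v_{0,xx})\,(\ln(e+\beta+|x|))^\beta\bigr\|_{L^\infty}\le C_0 . $$ Then there is $T_0$ with $0<T_0<T$ such that $\sup_{t\in[0,T_0]}\bigl(\|\rho(t)\|_{H^{s-1}}+\|u(t)\|_{H^s}+\|v(t)\|_{H^s}\bigr)<\infty$ and, for every $M$ that is at least this supremum, $$ \bigl\|(\rho,\rho_x,u,u_x,u_{xx},v,v_x,v_{xx})(t)\,(\ln(e+\beta+|x|))^\beta\bigr\|_{L^\infty}\le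 C_1\qquad\text{for all } t\in[0,T_0], $$ where the constant $C_1$ depends only on $M$, $C_0$, $\beta$ and $s$. -/

import Mathlib

open MeasureTheory Filter Topology Set
open scoped ENNReal NNReal FourierTransform ContDiff

noncomputable section

namespace DP3

/-- The norm of the Sobolev space `H^s(ℝ)`, `s ≥ 0`, of a real function `f`:
`‖(1 - ∂ₓ²)^{s/2} f‖_{L²} = ‖(1 + (2πξ)²)^{s/2} 𝓕 f‖_{L²}`, where `𝓕` is the Fourier transform on
`L²` (with kernel `e^{-2πixξ}`). It is `∞` if `f` is not square integrable, since
`H^s ⊆ L²` for `s ≥ 0`. -/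
def sobolevNorm (s : ℝ) (f : ℝ → ℝ) : ℝ≥0∞ :=
  open Classical in
  if h : MemLp (fun x => (f x : ℂ)) 2 volume then
    eLpNorm (fun ξ : ℝ => ((1 + (2 * Real.pi * ξ) ^ 2) ^ (s / 2) : ℝ) •
      (𝓕 (h.toLp (fun x => (f x : ℂ))) : Lp ℂ 2 (volume : Measure ℝ)) ξ) 2 volume
  else ⊤

/-- `f ∈ H^s(ℝ)`, `s > 1/2`. Such a class of functions has exactly one continuous
representative, and `f` is that representative. -/
def MemH (s : ℝ) (f : ℝ → ℝ) : Prop :=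
  Continuous f ∧ sobolevNorm s f < ⊤

/-- The norm of `(ρ, u, v)` in `H^{s-1} × H^s × H^s`. -/
def tripleNorm (s : ℝ) (ρ u v : ℝ → ℝ) : ℝ≥0∞ :=
  sobolevNorm (s - 1) ρ + sobolevNorm s u + sobolevNorm s v

/-- The time interval `[0, T)`, where `T` may be `∞`. -/
def timeInterval (T : EReal) : Set ℝ :=
  {t | 0 ≤ t ∧ (t : EReal) < T}

/-- The function `m = u - u_xx`. -/
def momentum (u : ℝ → ℝ) (x : ℝ) : ℝ :=
  u x - iteratedDeriv 2 u x

/-- `(ρ, u, v) ∈ C([0,T); H^{s-1} × H^s × H^s)` is a solution of the Cauchy problem for the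
3-component Degasperis-Procesi system

  `ρ_t + (ρuv)_x = 0`,
  `m_t + uv m_x + 3v u_x m + ρ² u = 0`,   `m = u - u_xx`,
  `n_t + uv n_x + 3u v_x n - ρ² v = 0`,   `n = v - v_xx`,

with initial data `(ρ₀, u₀, v₀)`. The equations hold at every time `t ∈ (0,T)` in the sense of
distributions in `x`, that is, after pairing with an arbitrary test function `ζ ∈ C_c^∞(ℝ)`; the
pairings of `ζ` with `(ρuv)_x` and with `uv m_x` (where `uv` is `C²` and `m` is continuous)
are `-∫ ρuv ζ_x` and `-∫ m (uvζ)_x`. -/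
structure IsSolution (s : ℝ) (T : EReal) (ρ₀ u₀ v₀ : ℝ → ℝ) (ρ u v : ℝ → ℝ → ℝ) : Prop where
  mem_rho : ∀ t ∈ timeInterval T, MemH (s - 1) (ρ t)
  mem_u : ∀ t ∈ timeInterval T, MemH s (u t)
  mem_v : ∀ t ∈ timeInterval T, MemH s (v t)
  continuous_in_time : ∀ t ∈ timeInterval T,
    Tendsto (fun τ => tripleNorm s (ρ τ - ρ t) (u τ - u t) (v τ - v t))
      (𝓝[timeInterval T] t) (𝓝 0)
  initial_rho : ρ 0 = ρ₀
  initial_u : u 0 = u₀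
  initial_v : v 0 = v₀
  eq_rho : ∀ ζ : ℝ → ℝ, ContDiff ℝ ∞ ζ → HasCompactSupport ζ →
    ∀ t : ℝ, 0 < t → (t : EReal) < T →
      HasDerivAt (fun τ => ∫ x, ρ τ x * ζ x)
        (∫ x, ρ t x * u t x * v t x * deriv ζ x) t
  eq_m : ∀ ζ : ℝ → ℝ, ContDiff ℝ ∞ ζ → HasCompactSupport ζ →
    ∀ t : ℝ, 0 < t → (t : EReal) < T →
      HasDerivAt (fun τ => ∫ x, momentum (u τ) x * ζ x)
        (∫ x, (momentum (u t) x * deriv (fun y => u t y * v t y * ζ y) x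
          - (3 * v t x * deriv (u t) x * momentum (u t) x + ρ t x ^ 2 * u t x) * ζ x)) t
  eq_n : ∀ ζ : ℝ → ℝ, ContDiff ℝ ∞ ζ → HasCompactSupport ζ →
    ∀ t : ℝ, 0 < t → (t : EReal) < T →
      HasDerivAt (fun τ => ∫ x, momentum (v τ) x * ζ x)
        (∫ x, (momentum (v t) x * deriv (fun y => u t y * v t y * ζ y) x
          - (3 * u t x * deriv (v t) x * momentum (v t) x - ρ t x ^ 2 * v t x) * ζ x)) t

/-- The weight `(ln(e + β + |x|))^β`. -/
def logWeight (β x : ℝ) : ℝ :=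
  Real.log (Real.exp 1 + β + |x|) ^ β

/-- The weighted norm
`‖(ρ, ρ_x, u, u_x, u_xx, v, v_x, v_xx) (ln(e + β + |x|))^β‖_{L^∞}`. -/
def weightedNorm (β : ℝ) (ρ u v : ℝ → ℝ) : ℝ≥0∞ :=
  eLpNorm (fun x => logWeight β x •
    (![ρ x, deriv ρ x, u x, deriv u x, iteratedDeriv 2 u x,
      v x, deriv v x, iteratedDeriv 2 v x] : Fin 8 → ℝ)) ⊤ volume

end DP3

end

/-! All three equations are transport equations `f_t + b f_x = G` with the same velocity `b = uv`,
for the four unknowns `ρ`, `ρ_x`, `m` and `n`. In each case `|G|` is at most a constant times `|f|`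
plus a constant times a quantity whose weighted bound is already known. The density comes first,
since `G = -b_x ρ`; then `ρ_x`, `m` and `n` are driven by `ρ`. Along a characteristic the position
moves by at most `B t`, where `B` bounds `|b|`, so the weight changes only by a bounded factor.
Gronwall's inequality for `|f|` along the curve thus propagates the weighted bound
(`weighted_bound_of_transport`, applied in `weightedBound_of_regular`).

Weighted bounds on `m` pass to `u`, `u_x` and `u_xx` because `log (e + β + |x|) ^ β` grows by at
most a factor `c * exp (|x - y| / 2)` between two points (`logWeight_le`), and the Green function of
`1 - ∂ₓ²` decays at the faster rate `exp (-|x - y|)` (`weighted_bound_of_momentum`).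

The analytic difficulty is low regularity: `ρ_x`, `m` and `n` are merely continuous and solve their
equations only weakly. Mollifying along the characteristic produces a commutator that vanishes in
the limit because `b` is `C¹` in space (`sub_eq_integral_along_characteristic`). No further
derivative of the solution is needed.

The sup bounds and the joint continuity come from the Sobolev embedding (`MemH.contDiff_and_bound`,
`isBddCont_iteratedDeriv`). The time interval comes from continuity at time zero; the constants see
it only through `T₀ ≤ 1`. -/

namespace DP3

/-! ### Fourier inversion and the Sobolev embedding -/

/-- A continuous square integrable function whose `L²` Fourier transform is integrable is given
pointwise by the inverse Fourier integral. -/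
theorem eq_fourier_of_integrable_fourier {f : ℝ → ℂ} (hf : Continuous f) (h : MemLp f 2 volume)
    (hg : Integrable (𝓕 (h.toLp f) : Lp ℂ 2 (volume : Measure ℝ)) volume) :
    f = 𝓕 (fun ξ => (𝓕 (h.toLp f) : Lp ℂ 2 (volume : Measure ℝ)) (-ξ)) := by
  set g : Lp ℂ 2 (volume : Measure ℝ) := 𝓕 (h.toLp f) with hgdef
  have hgn : Integrable (fun ξ => g (-ξ)) volume := hg.comp_neg
  have hFc : Continuous (𝓕 (fun ξ => g (-ξ))) :=
    VectorFourier.fourierIntegral_continuous Real.continuous_fourierChar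
      (by exact (innerSL ℝ).continuous₂) hgn
  refine (Continuous.ae_eq_iff_eq (volume : Measure ℝ) hf hFc).1 ?_
  refine ae_eq_of_integral_contDiff_smul_eq hf.locallyIntegrable hFc.locallyIntegrable ?_
  intro η hη hηc
  let ψ : SchwartzMap ℝ ℂ := HasCompactSupport.toSchwartzMap (f := fun x => (η x : ℂ))
    (hηc.comp_left (g := Complex.ofReal) rfl) (Complex.ofRealCLM.contDiff.comp hη)
  have hψ : ∀ x, ψ x = (η x : ℂ) := fun x => rfl
  -- The `L²` and the distributional Fourier transforms agree. Testing against `𝓕⁻ ψ` gives `∫ ψ f =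
  -- ∫ (𝓕⁻ ψ) g`, and self-adjointness of the Fourier integral then moves the transform onto the
  -- integrable function `g`.
  have key := Lp.fourier_toTemperedDistribution_eq (h.toLp f)
  have key2 := congrArg (fun D => D (𝓕⁻ ψ : SchwartzMap ℝ ℂ)) key
  simp only [TemperedDistribution.fourier_apply, Lp.toTemperedDistribution_apply,
    FourierTransform.fourier_fourierInv_eq] at key2
  have e1 : ∫ x, ψ x • (h.toLp f) x = ∫ x, η x • f x := by
    refine integral_congr_ae ?_
    filter_upwards [h.coeFn_toLp] with x hx
    rw [hx, hψ]; simp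
  have e2 : ∫ ξ, (𝓕⁻ ψ : SchwartzMap ℝ ℂ) ξ • g ξ
      = ∫ ξ, (𝓕 (ψ : ℝ → ℂ)) ξ • g (-ξ) := by
    rw [← integral_neg_eq_self]
    refine integral_congr_ae (Eventually.of_forall fun ξ => ?_)
    simp only
    rw [SchwartzMap.fourierInv_coe, Real.fourierInv_eq_fourier_neg, neg_neg]
  have e3 : ∫ ξ, (𝓕 (ψ : ℝ → ℂ)) ξ • g (-ξ)
      = ∫ x, ψ x • 𝓕 (fun ξ => g (-ξ)) x := by
    have := VectorFourier.integral_fourierIntegral_smul_eq_flip (μ := (volume : Measure ℝ))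
      (ν := (volume : Measure ℝ)) (L := innerₗ ℝ) Real.continuous_fourierChar
      (by exact (innerSL ℝ).continuous₂) ψ.integrable hgn
    rw [flip_innerₗ] at this
    exact this
  rw [← e1, key2, e2, e3]
  refine integral_congr_ae (Eventually.of_forall fun x => ?_)
  simp [hψ]

/-- The constant of the embedding `H^s(ℝ) ⊆ C^k(ℝ)`, `s > k + 1/2`. -/
noncomputable def sobolevConst (s : ℝ) (k : ℕ) : ℝ≥0∞ :=
  eLpNorm (fun ξ : ℝ => (2 * Real.pi * ξ) ^ k * (1 + (2 * Real.pi * ξ) ^ 2) ^ (-(s / 2))) 2 volume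

theorem continuous_sobolevWeight (r : ℝ) :
    Continuous fun ξ : ℝ => (1 + (2 * Real.pi * ξ) ^ 2) ^ r :=
  (by fun_prop : Continuous fun ξ : ℝ => 1 + (2 * Real.pi * ξ) ^ 2).rpow_const
    fun ξ => Or.inl (by positivity)

/-- The square of the integrand is at most `(1 + ξ²) ^ (-(s - k))`, which is integrable on the line
exactly because `2 (s - k) > 1`. -/
theorem sobolevConst_lt_top {s : ℝ} {k : ℕ} (hk : (k : ℝ) + 1 / 2 < s) :
    sobolevConst s k < ⊤ := by
  have hc : Continuous fun ξ : ℝ =>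
      (2 * Real.pi * ξ) ^ k * (1 + (2 * Real.pi * ξ) ^ 2) ^ (-(s / 2)) :=
    (by fun_prop : Continuous fun ξ : ℝ => (2 * Real.pi * ξ) ^ k).mul (continuous_sobolevWeight _)
  refine MemLp.eLpNorm_lt_top ((memLp_two_iff_integrable_sq hc.aestronglyMeasurable).2 ?_)
  have hi : Integrable (fun ξ : ℝ => ((1 : ℝ) + ‖ξ‖ ^ 2) ^ (-(2 * (s - k)) / 2)) volume :=
    integrable_rpow_neg_one_add_norm_sq (by simp; linarith)
  refine hi.mono' (hc.pow 2).aestronglyMeasurable (Eventually.of_forall fun ξ => ?_)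
  have hp : 0 < 1 + (2 * Real.pi * ξ) ^ 2 := by positivity
  rw [Real.norm_of_nonneg (sq_nonneg _), mul_pow, ← pow_mul, mul_comm k 2, pow_mul,
    ← Real.rpow_natCast (_ ^ (-(s / 2))) 2, ← Real.rpow_mul hp.le]
  calc ((2 * Real.pi * ξ) ^ 2) ^ k * (1 + (2 * Real.pi * ξ) ^ 2) ^ (-(s / 2) * (2 : ℕ))
      ≤ (1 + (2 * Real.pi * ξ) ^ 2) ^ k * (1 + (2 * Real.pi * ξ) ^ 2) ^ (-(s / 2) * (2 : ℕ)) := by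
        gcongr; linarith
    _ = (1 + (2 * Real.pi * ξ) ^ 2) ^ (-(s - k)) := by
        rw [← Real.rpow_natCast _ k, ← Real.rpow_add hp]; congr 1; push_cast; ring
    _ ≤ (1 + ‖ξ‖ ^ 2) ^ (-(s - k)) := by
        refine Real.rpow_le_rpow_of_nonpos (by positivity) ?_ (by linarith)
        have : 1 ≤ (2 * Real.pi) ^ 2 := by nlinarith [Real.pi_gt_three]
        rw [Real.norm_eq_abs, sq_abs, mul_pow]
        nlinarith [sq_nonneg ξ]
    _ = _ := by congr 1; ring

/-- Cauchy–Schwarz, after inserting the Sobolev weight and its inverse. Integrability of `ξ ^ k 𝓕 f`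
is what makes `f` of class `C^k`. -/
theorem eLpNorm_pow_smul_le {s : ℝ} (k : ℕ) {g : ℝ → ℂ}
    (hg : AEStronglyMeasurable g volume) :
    eLpNorm (fun ξ : ℝ => ((2 * Real.pi * ξ) ^ k : ℝ) • g ξ) 1 volume ≤ sobolevConst s k *
      eLpNorm (fun ξ : ℝ => ((1 + (2 * Real.pi * ξ) ^ 2) ^ (s / 2) : ℝ) • g ξ) 2 volume := by
  have hc : Continuous fun ξ : ℝ =>
      (2 * Real.pi * ξ) ^ k * (1 + (2 * Real.pi * ξ) ^ 2) ^ (-(s / 2)) :=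
    (by fun_prop : Continuous fun ξ : ℝ => (2 * Real.pi * ξ) ^ k).mul (continuous_sobolevWeight _)
  have := eLpNorm_smul_le_mul_eLpNorm (p := 2) (q := 2) (r := 1) (μ := volume)
    ((continuous_sobolevWeight (s / 2)).aestronglyMeasurable.smul hg) hc.aestronglyMeasurable
  refine le_trans (le_of_eq ?_) this
  congr 1
  ext1 ξ
  have hp : 0 < 1 + (2 * Real.pi * ξ) ^ 2 := by positivity
  simp only [Pi.smul_apply', smul_smul]
  rw [mul_assoc ((2 * Real.pi * ξ) ^ k), ← Real.rpow_add hp, neg_add_cancel, Real.rpow_zero,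
    mul_one]

theorem sobolevNorm_of_memLp (s : ℝ) {f : ℝ → ℝ} (h : MemLp (fun x => (f x : ℂ)) 2 volume) :
    sobolevNorm s f = eLpNorm (fun ξ : ℝ => ((1 + (2 * Real.pi * ξ) ^ 2) ^ (s / 2) : ℝ) •
      (𝓕 (h.toLp (fun x => (f x : ℂ))) : Lp ℂ 2 (volume : Measure ℝ)) ξ) 2 volume := by
  rw [sobolevNorm, dif_pos h]

theorem memLp_of_sobolevNorm_lt_top {s : ℝ} {f : ℝ → ℝ} (h : sobolevNorm s f < ⊤) :
    MemLp (fun x => (f x : ℂ)) 2 volume := by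
  by_contra hn
  simp [sobolevNorm, hn] at h

/-- The Sobolev embedding `H^s(ℝ) ⊆ C^k(ℝ)`, `s > k + 1/2`. -/
theorem MemH.contDiff_and_bound {s : ℝ} {k : ℕ} (hk : (k : ℝ) + 1 / 2 < s) {f : ℝ → ℝ}
    (hf : MemH s f) :
    ContDiff ℝ k f ∧ ∀ x, ‖iteratedDeriv k f x‖ₑ ≤ sobolevConst s k * sobolevNorm s f := by
  have h := memLp_of_sobolevNorm_lt_top hf.2
  have hN := sobolevNorm_of_memLp s h
  set g : Lp ℂ 2 (volume : Measure ℝ) := 𝓕 (h.toLp (fun x => (f x : ℂ))) with hg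
  have hgm : AEStronglyMeasurable g volume := Lp.aestronglyMeasurable g
  have hfin : ∀ j : ℕ, j ≤ k →
      eLpNorm (fun ξ : ℝ => ((2 * Real.pi * ξ) ^ j : ℝ) • g ξ) 1 volume < ⊤ := by
    intro j hj
    refine (eLpNorm_pow_smul_le (s := s) j hgm).trans_lt ?_
    rw [← hN]
    have : (j : ℝ) ≤ k := by exact_mod_cast hj
    exact ENNReal.mul_lt_top (sobolevConst_lt_top (by linarith)) hf.2
  have hint : ∀ j : ℕ, j ≤ k → Integrable (fun ξ : ℝ => ((2 * Real.pi * ξ) ^ j : ℝ) • g ξ) := by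
    intro j hj
    rw [← memLp_one_iff_integrable]
    exact ⟨(by fun_prop : Continuous fun ξ : ℝ => (2 * Real.pi * ξ) ^ j).aestronglyMeasurable.smul
      hgm, hfin j hj⟩
  have hg0 : Integrable g volume := by simpa using hint 0 (Nat.zero_le _)
  have hrep := eq_fourier_of_integrable_fourier
    (Complex.continuous_ofReal.comp hf.1) h hg0
  have hint' : ∀ j : ℕ, (j : ℕ∞) ≤ (k : ℕ∞) → Integrable (fun ξ : ℝ => ξ ^ j • g (-ξ)) := by
    intro j hj
    have h1 := ((hint j (by exact_mod_cast hj)).comp_neg).smul ((-(2 * Real.pi)) ^ j)⁻¹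
    refine h1.congr (Eventually.of_forall fun ξ => ?_)
    have : (-(2 * Real.pi)) ^ j ≠ 0 := pow_ne_zero _ (by simp [Real.pi_ne_zero])
    simp only [Pi.smul_apply, smul_smul]
    congr 1
    rw [show 2 * Real.pi * -ξ = -(2 * Real.pi) * ξ by ring, mul_pow]
    field_simp
  have hcd : ContDiff ℝ k (fun x => (f x : ℂ)) := by
    rw [show (fun x => (f x : ℂ)) = 𝓕 (fun ξ => g (-ξ)) from hrep]
    refine Real.contDiff_fourier (N := (k : ℕ∞)) fun j hj => ?_
    refine (hint' j hj).norm.congr (Eventually.of_forall fun ξ => ?_)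
    simp
  have hcdf : ContDiff ℝ k f := by
    have := Complex.reCLM.contDiff.comp hcd (n := k)
    simpa [Function.comp_def] using this
  refine ⟨hcdf, fun x => ?_⟩
  have hnorm : ‖iteratedDeriv k f x‖ = ‖iteratedDeriv k (fun x => (f x : ℂ)) x‖ := by
    rw [← norm_iteratedFDeriv_eq_norm_iteratedDeriv, ← norm_iteratedFDeriv_eq_norm_iteratedDeriv]
    exact (Complex.ofRealLI.norm_iteratedFDeriv_comp_left hcdf.contDiffAt le_rfl).symm
  have hb : ‖iteratedDeriv k f x‖ ≤ ∫ ξ, ‖((2 * Real.pi * ξ) ^ k : ℝ) • g ξ‖ := by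
    rw [hnorm, show (fun x => (f x : ℂ)) = 𝓕 (fun ξ => g (-ξ)) from hrep,
      Real.iteratedDeriv_fourier hint' le_rfl]
    refine (VectorFourier.norm_fourierIntegral_le_integral_norm _ _ _ _ _).trans (le_of_eq ?_)
    rw [← integral_neg_eq_self]
    refine integral_congr_ae (Eventually.of_forall fun ξ => ?_)
    simp
  rw [hN]
  refine le_trans ?_ (eLpNorm_pow_smul_le (s := s) k hgm)
  rw [eLpNorm_one_eq_lintegral_enorm, ← ofReal_integral_norm_eq_lintegral_enorm (hint k le_rfl),
    ← ofReal_norm]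
  exact ENNReal.ofReal_le_ofReal hb

theorem sobolevNorm_add_le (s : ℝ) (f g : ℝ → ℝ) :
    sobolevNorm s (f + g) ≤ sobolevNorm s f + sobolevNorm s g := by
  rcases eq_or_ne (sobolevNorm s f) ⊤ with hf | hf
  · simp [hf]
  rcases eq_or_ne (sobolevNorm s g) ⊤ with hg | hg
  · simp [hg]
  have h1 := memLp_of_sobolevNorm_lt_top hf.lt_top
  have h2 := memLp_of_sobolevNorm_lt_top hg.lt_top
  have h3 : MemLp (fun x => ((f + g) x : ℂ)) 2 volume := by
    convert h1.add h2 using 1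
    ext x; simp
  have e : h3.toLp = h1.toLp + h2.toLp := by
    rw [← MemLp.toLp_add h1 h2]
    exact MemLp.toLp_congr _ _ (Eventually.of_forall fun x => by simp)
  rw [sobolevNorm_of_memLp s h1, sobolevNorm_of_memLp s h2, sobolevNorm_of_memLp s h3, e,
    FourierTransform.fourier_add]
  have hm := fun (F : Lp ℂ 2 (volume : Measure ℝ)) =>
    (continuous_sobolevWeight (s / 2)).aestronglyMeasurable.smul (Lp.aestronglyMeasurable F)
  refine le_trans (le_of_eq ?_) (eLpNorm_add_le (hm _) (hm _) (by norm_num))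
  refine eLpNorm_congr_ae ?_
  filter_upwards [Lp.coeFn_add (𝓕 h1.toLp : Lp ℂ 2 (volume : Measure ℝ)) (𝓕 h2.toLp)] with ξ hξ
  rw [hξ]
  simp only [Pi.add_apply, smul_add]

/-! ### Moderate growth of the logarithmic weight -/

/-- The constant in the moderate growth estimate `logWeight_le` of the logarithmic weight. -/
noncomputable def weightConst (β : ℝ) : ℝ := max 1 (2 * β) ^ β

theorem one_le_weightConst {β : ℝ} (hβ : 0 < β) : 1 ≤ weightConst β :=
  Real.one_le_rpow (le_max_left _ _) hβ.le

theorem one_le_log_weight {β : ℝ} (hβ : 0 < β) (x : ℝ) :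
    1 ≤ Real.log (Real.exp 1 + β + |x|) := by
  rw [Real.le_log_iff_exp_le (by positivity)]
  linarith [abs_nonneg x]

theorem logWeight_pos {β : ℝ} (hβ : 0 < β) (x : ℝ) : 0 < logWeight β x :=
  Real.rpow_pos_of_pos (by linarith [one_le_log_weight hβ x]) _

theorem logWeight_neg (β x : ℝ) : logWeight β (-x) = logWeight β x := by
  simp [logWeight]

theorem continuous_logWeight {β : ℝ} (hβ : 0 < β) : Continuous (logWeight β) := by
  unfold logWeight
  refine Continuous.rpow_const (Continuous.log (by fun_prop) fun x => ?_) fun x => Or.inr hβ.le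
  positivity

/-- With `r = |x - y|`, the argument of the logarithm grows by a factor at most `1 + r`, and since
the logarithm at `y` is at least `1`, so does the logarithm itself. The exponential rate `1/2` is
chosen to lie strictly below the rate `1` of the Green function of `1 - ∂ₓ²`. -/
theorem logWeight_le {β : ℝ} (hβ : 0 < β) (x y : ℝ) :
    logWeight β x ≤ weightConst β * Real.exp (|x - y| / 2) * logWeight β y := by
  set κ := max 1 (2 * β) with hκ
  have hκ1 : 1 ≤ κ := le_max_left _ _
  have hκ2 : 2 * β ≤ κ := le_max_right _ _
  set r := |x - y| with hr
  have hr0 : 0 ≤ r := abs_nonneg _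
  have hx := one_le_log_weight hβ x
  have hy := one_le_log_weight hβ y
  have hA : 0 < Real.exp 1 + β + |x| := by positivity
  have hB : 0 < Real.exp 1 + β + |y| := by positivity
  have hB1 : 1 ≤ Real.exp 1 + β + |y| := by
    have := Real.add_one_le_exp 1
    linarith [abs_nonneg y]
  have h1 : Real.exp 1 + β + |x| ≤ (Real.exp 1 + β + |y|) * (1 + r) := by
    have : |x| ≤ |y| + r := by
      have := abs_add_le y (x - y)
      simpa using this
    nlinarith
  have h2 : Real.log (Real.exp 1 + β + |x|) ≤ Real.log (Real.exp 1 + β + |y|) * (1 + r) := by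
    have h3 := Real.log_le_log hA h1
    rw [Real.log_mul hB.ne' (by linarith)] at h3
    have h4 : Real.log (1 + r) ≤ r := by
      have := Real.log_le_sub_one_of_pos (show 0 < 1 + r by linarith)
      linarith
    nlinarith
  -- The rate `1 / (2 β)` turns into `1/2` after raising to the power `β`; the constant `κ = max 1
  -- (2 β)` absorbs both terms of `1 + r`.
  have h5 : 1 + r ≤ κ * Real.exp (r / (2 * β)) := by
    have h6 := Real.add_one_le_exp (r / (2 * β))
    have h7 : r = 2 * β * (r / (2 * β)) := by field_simp
    have h8 : 0 ≤ r / (2 * β) := by positivity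
    nlinarith
  unfold logWeight weightConst
  calc Real.log (Real.exp 1 + β + |x|) ^ β
      ≤ (κ * Real.exp (r / (2 * β)) * Real.log (Real.exp 1 + β + |y|)) ^ β := by
        refine Real.rpow_le_rpow (by linarith) (h2.trans ?_) hβ.le
        rw [mul_comm]
        gcongr
    _ = _ := by
        rw [Real.mul_rpow (by positivity) (by linarith), Real.mul_rpow (by linarith)
          (Real.exp_pos _).le, ← Real.exp_mul]
        congr 3
        field_simp

/-! ### Weighted elliptic estimates -/

/-- Weighted estimate for the bounded solution of `w - w' = m`. -/
theorem weighted_bound_of_sub_deriv {β : ℝ} (hβ : 0 < β) {w m : ℝ → ℝ} {B K : ℝ}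
    (hw : ∀ x, HasDerivAt w (w x - m x) x) (hB : ∀ x, |w x| ≤ B)
    (hm : ∀ x, |m x| * logWeight β x ≤ K) (x : ℝ) :
    |w x| * logWeight β x ≤ 2 * weightConst β * K := by
  have hφ := logWeight_pos hβ
  have hc := one_le_weightConst hβ
  have hK : 0 ≤ K := (mul_nonneg (abs_nonneg _) (hφ 0).le).trans (hm 0)
  -- This is the constant for which `|exp (-y) m y| ≤ A exp (-y / 2)` on `[x, ∞)`.
  set A := K * weightConst β * Real.exp (-x / 2) / logWeight β x with hA
  have hexp : ∀ y, HasDerivAt (fun y => Real.exp (-y)) (-Real.exp (-y)) y := fun y => by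
    simpa using (hasDerivAt_neg y).exp
  have hexp2 : ∀ y, HasDerivAt (fun y => -2 * A * Real.exp (-y / 2)) (A * Real.exp (-y / 2)) y :=
    fun y => by
      have := (((hasDerivAt_neg y).div_const 2).exp).const_mul (-2 * A)
      exact this.congr_deriv (by ring)
  have hQ : ∀ y, HasDerivAt (fun y => Real.exp (-y) * w y) (-(Real.exp (-y) * m y)) y := fun y => by
    have := (hexp y).mul (hw y)
    exact this.congr_deriv (by ring)
  have hQb : ∀ y, x ≤ y → |Real.exp (-y) * m y| ≤ A * Real.exp (-y / 2) := by
    intro y hy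
    rw [abs_mul, abs_of_pos (Real.exp_pos _)]
    have h1 := logWeight_le hβ x y
    have h2 := hm y
    rw [abs_sub_comm, abs_of_nonneg (sub_nonneg.2 hy)] at h1
    have h3 : |m y| ≤ K * (weightConst β * Real.exp ((y - x) / 2)) / logWeight β x := by
      rw [le_div_iff₀ (hφ x)]
      calc |m y| * logWeight β x
          ≤ |m y| * (weightConst β * Real.exp ((y - x) / 2) * logWeight β y) := by gcongr
        _ = |m y| * logWeight β y * (weightConst β * Real.exp ((y - x) / 2)) := by ring
        _ ≤ _ := by gcongr
    calc Real.exp (-y) * |m y|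
        ≤ Real.exp (-y) * (K * (weightConst β * Real.exp ((y - x) / 2)) / logWeight β x) := by
          gcongr
      _ = K * weightConst β * (Real.exp (-y) * Real.exp ((y - x) / 2)) / logWeight β x := by ring
      _ = K * weightConst β * (Real.exp (-x / 2) * Real.exp (-y / 2)) / logWeight β x := by
          rw [← Real.exp_add, ← Real.exp_add]; ring_nf
      _ = A * Real.exp (-y / 2) := by rw [hA]; ring
  have hlim1 : Tendsto (fun y => Real.exp (-y)) atTop (𝓝 0) := Real.tendsto_exp_neg_atTop_nhds_zero
  -- Boundedness of `w` enters here: it excludes the homogeneous solution `exp`.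
  have hlimQ : Tendsto (fun y => Real.exp (-y) * w y) atTop (𝓝 0) := by
    refine squeeze_zero_norm (fun y => ?_) (by simpa using hlim1.mul_const B)
    rw [norm_mul, Real.norm_of_nonneg (Real.exp_pos _).le]
    exact mul_le_mul_of_nonneg_left (hB y) (Real.exp_pos _).le
  have hlimP : Tendsto (fun y => -2 * A * Real.exp (-y / 2)) atTop (𝓝 0) := by
    have : Tendsto (fun y : ℝ => y / 2) atTop atTop := tendsto_id.atTop_div_const (by norm_num)
    have := (hlim1.comp this).const_mul (-2 * A)
    simpa [Function.comp_def, neg_div] using this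
  -- In place of the formula `w x = ∫_x^∞ exp (x - y) m y dy`, a monotone comparison: `σ exp (-y) w
  -- y - 2 A exp (-y / 2)` is nondecreasing on `[x, ∞)` and tends to `0`, so it is nonpositive at
  -- `x`.
  have main : ∀ σ : ℝ, |σ| = 1 → σ * (Real.exp (-x) * w x) ≤ 2 * A * Real.exp (-x / 2) := by
    intro σ hσ
    have hd : ∀ y, HasDerivAt
        (fun y => -2 * A * Real.exp (-y / 2) + σ * (Real.exp (-y) * w y))
        (A * Real.exp (-y / 2) + σ * (-(Real.exp (-y) * m y))) y := fun y =>
      (hexp2 y).add ((hQ y).const_mul σ)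
    have hmono : MonotoneOn (fun y => -2 * A * Real.exp (-y / 2) + σ * (Real.exp (-y) * w y))
        (Ici x) := by
      refine monotoneOn_of_deriv_nonneg (convex_Ici x)
        (fun y _ => (hd y).continuousAt.continuousWithinAt)
        (fun y _ => (hd y).differentiableAt.differentiableWithinAt) fun y hy => ?_
      rw [(hd y).deriv]
      rw [interior_Ici] at hy
      have h1 := hQb y hy.le
      have h2 : |σ * (-(Real.exp (-y) * m y))| ≤ A * Real.exp (-y / 2) := by
        rw [abs_mul, hσ, one_mul, abs_neg]; exact h1
      linarith [(abs_le.1 h2).1]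
    have hlim := hlimP.add (hlimQ.const_mul σ)
    rw [mul_zero, add_zero] at hlim
    have := ge_of_tendsto hlim (eventually_ge_atTop x |>.mono fun y hy =>
      hmono self_mem_Ici hy hy)
    simp only at this
    linarith
  have h1 := main 1 (by simp)
  have h2 := main (-1) (by simp)
  have h3 : |Real.exp (-x) * w x| ≤ 2 * A * Real.exp (-x / 2) := abs_le.2 ⟨by linarith, by linarith⟩
  rw [abs_mul, abs_of_pos (Real.exp_pos _)] at h3
  have h4 : 2 * A * Real.exp (-x / 2) =
      Real.exp (-x) * (2 * weightConst β * K / logWeight β x) := by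
    rw [show Real.exp (-x) = Real.exp (-x / 2) * Real.exp (-x / 2) by
      rw [← Real.exp_add]; ring_nf, hA]
    ring
  rw [h4] at h3
  have h5 := le_of_mul_le_mul_left h3 (Real.exp_pos _)
  rwa [le_div_iff₀ (hφ x)] at h5

theorem hasDerivAt_deriv_of_contDiff_two {w : ℝ → ℝ} (hw : ContDiff ℝ 2 w) (x : ℝ) :
    HasDerivAt (deriv w) (iteratedDeriv 2 w x) x := by
  have := (hw.differentiable_iteratedDeriv 1 (by norm_num) x).hasDerivAt
  rw [iteratedDeriv_one] at this
  rwa [show iteratedDeriv 2 w = deriv (deriv w) by rw [iteratedDeriv_succ, iteratedDeriv_one]]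

/-- Weighted estimates for the bounded solution of `u - u'' = m`. -/
theorem weighted_bound_of_momentum {β : ℝ} (hβ : 0 < β) {u : ℝ → ℝ} {B K : ℝ}
    (hu : ContDiff ℝ 2 u) (hB : ∀ x, |u x| ≤ B) (hB' : ∀ x, |deriv u x| ≤ B)
    (hm : ∀ x, |momentum u x| * logWeight β x ≤ K) (x : ℝ) :
    |u x| * logWeight β x ≤ 4 * weightConst β ^ 2 * K ∧
    |deriv u x| * logWeight β x ≤ 6 * weightConst β ^ 2 * K ∧
    |iteratedDeriv 2 u x| * logWeight β x ≤ 5 * weightConst β ^ 2 * K := by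
  have hφ := logWeight_pos hβ
  have hc := one_le_weightConst hβ
  have hK : 0 ≤ K := (mul_nonneg (abs_nonneg _) (hφ 0).le).trans (hm 0)
  have hd1 : ∀ x, HasDerivAt u (deriv u x) x := fun x =>
    (hu.differentiable (by norm_num) x).hasDerivAt
  have hd2 := hasDerivAt_deriv_of_contDiff_two hu
  -- The factorization `1 - ∂ₓ² = (1 - ∂ₓ)(1 + ∂ₓ)`: the function `w = u + u'` solves `w - w' = m`.
  -- The remaining equation `u + u' = w` takes the same form after the reflection `x ↦ -x`, which
  -- preserves the weight.
  have hw : ∀ x, |u x + deriv u x| * logWeight β x ≤ 2 * weightConst β * K := by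
    refine weighted_bound_of_sub_deriv hβ (B := B + B) (m := momentum u) (fun x => ?_)
      (fun x => (abs_add_le _ _).trans (add_le_add (hB x) (hB' x))) hm
    have := (hd1 x).add (hd2 x)
    exact this.congr_deriv (by simp only [momentum]; ring)
  have hu0 : ∀ x, |u x| * logWeight β x ≤ 2 * weightConst β * (2 * weightConst β * K) := by
    intro x
    have := weighted_bound_of_sub_deriv hβ (w := fun x => u (-x))
      (m := fun x => u (-x) + deriv u (-x)) (fun x => ?_) (fun x => hB (-x))
      (fun x => by have := hw (-x); rwa [logWeight_neg] at this) (-x)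
    · simpa [logWeight_neg] using this
    · have := (hd1 (-x)).comp x (hasDerivAt_neg x)
      exact this.congr_deriv (by ring)
  have hcK : weightConst β * K ≤ weightConst β ^ 2 * K := by
    rw [sq, mul_assoc]; exact le_mul_of_one_le_left (by positivity) hc
  have hK' : K ≤ weightConst β ^ 2 * K := le_mul_of_one_le_left hK (one_le_pow₀ hc)
  have h1 := hu0 x
  have h2 := hw x
  have h3 := hm x
  refine ⟨by linarith, ?_, ?_⟩
  · have : |deriv u x| ≤ |u x + deriv u x| + |u x| := by
      have := abs_sub (u x + deriv u x) (u x)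
      simpa using this
    have := mul_le_mul_of_nonneg_right this (hφ x).le
    rw [add_mul] at this
    linarith
  · have : |iteratedDeriv 2 u x| ≤ |u x| + |momentum u x| := by
      have := abs_sub (u x) (momentum u x)
      simpa [momentum] using this
    have := mul_le_mul_of_nonneg_right this (hφ x).le
    rw [add_mul] at this
    linarith

/-! ### Weak transport equations along characteristics -/

/-- The mean value inequality for `Φ τ x - c x` near `a`, uniformly in `τ`. It supplies the spatial
half of a chain rule for `τ ↦ Φ τ (X τ)` without any differentiability of `Φ` in `τ`. -/
theorem isLittleO_sub_sub_of_tendsto_deriv {Φ Φ' : ℝ → ℝ → ℝ} {X : ℝ → ℝ} {l : Filter ℝ} {a c : ℝ}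
    (hΦ : ∀ᶠ τ in l, ∀ x, HasDerivAt (Φ τ) (Φ' τ x) x)
    (hlim : Tendsto (fun p : ℝ × ℝ => Φ' p.1 p.2) (l ×ˢ 𝓝 a) (𝓝 c))
    (hX : Tendsto X l (𝓝 a)) :
    (fun τ => Φ τ (X τ) - Φ τ a - c * (X τ - a)) =o[l] fun τ => X τ - a := by
  rw [Asymptotics.isLittleO_iff]
  intro ε hε
  have h1 := (Metric.tendsto_nhds.1 hlim) ε hε
  obtain ⟨P, hP, Q, hQ, hPQ⟩ := eventually_prod_iff.1 h1
  obtain ⟨δ, hδ, hball⟩ := Metric.eventually_nhds_iff_ball.1 hQ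
  filter_upwards [hΦ, hP, hX.eventually (Metric.ball_mem_nhds a hδ)] with τ h2 h3 h4
  have h5 := (convex_ball a δ).norm_image_sub_le_of_norm_hasDerivWithin_le (C := ε)
    (f := fun x => Φ τ x - c * x) (f' := fun x => Φ' τ x - c)
    (fun x _ => ((h2 x).sub (((hasDerivAt_id x).const_mul c).congr_deriv
      (mul_one c))).hasDerivWithinAt)
    (fun x hx => by simpa [Real.dist_eq] using (hPQ h3 (hball x hx)).le)
    (Metric.mem_ball_self hδ) h4
  rw [show Φ τ (X τ) - Φ τ a - c * (X τ - a) = Φ τ (X τ) - c * X τ - (Φ τ a - c * a) by ring]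
  exact h5

/-- Time derivative of the pairing of a weak solution of `f_t + b f_x = G` with a smooth kernel
that is transported along a characteristic. -/
theorem hasDerivAt_integral_mul_kernel {t₀ F t : ℝ} {f b bx G : ℝ → ℝ → ℝ} {X : ℝ → ℝ}
    (hf : ContinuousOn (Function.uncurry f) (Icc 0 t₀ ×ˢ univ))
    (hF : ∀ s ∈ Icc 0 t₀, ∀ x, |f s x| ≤ F)
    (hb : ∀ s ∈ Icc 0 t₀, ∀ x, HasDerivAt (b s) (bx s x) x)
    (hbx : ∀ s ∈ Icc 0 t₀, Continuous (bx s))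
    (hG : ∀ s ∈ Icc 0 t₀, Continuous (G s))
    (ht : t ∈ Ioo 0 t₀)
    (heq : ∀ ζ : ℝ → ℝ, ContDiff ℝ ∞ ζ → HasCompactSupport ζ →
      HasDerivAt (fun τ => ∫ x, f τ x * ζ x)
        (∫ x, (f t x * deriv (fun y => b t y * ζ y) x + G t x * ζ x)) t)
    (hX : HasDerivAt X (b t (X t)) t)
    {ζ : ℝ → ℝ} (hζ : ContDiff ℝ ∞ ζ) (hζc : HasCompactSupport ζ) :
    HasDerivAt (fun τ => ∫ y, f τ y * ζ (X τ - y))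
      (∫ y, (f t y * (bx t y * ζ (X t - y) - (b t y - b t (X t)) * deriv ζ (X t - y))
        + G t y * ζ (X t - y))) t := by
  have htI : t ∈ Icc 0 t₀ := Ioo_subset_Icc_self ht
  have hnhds : Icc (0 : ℝ) t₀ ∈ 𝓝 t := Icc_mem_nhds ht.1 ht.2
  have hft : ∀ s ∈ Icc 0 t₀, Continuous (f s) := fun s hs =>
    hf.comp_continuous (f := fun x => (s, x)) (by fun_prop) fun x => ⟨hs, mem_univ _⟩
  have hbc : Continuous (b t) :=
    continuous_iff_continuousAt.2 fun x => (hb t htI x).continuousAt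
  have hd : ∀ x, HasDerivAt ζ (deriv ζ x) x := fun x =>
    (hζ.differentiable (by simp) x).hasDerivAt
  have hζ' : Continuous (deriv ζ) := hζ.continuous_deriv (by simp)
  have hζ'c : HasCompactSupport (deriv ζ) := hζc.deriv
  -- the reflected translate of a compactly supported function
  have hrefl : ∀ {g : ℝ → ℝ}, HasCompactSupport g → ∀ a : ℝ,
      HasCompactSupport fun y => g (a - y) := fun {g} hg a =>
    hg.comp_homeomorph (Homeomorph.subLeft a)
  have hreflD : ∀ a y, HasDerivAt (fun y => ζ (a - y)) (-deriv ζ (a - y)) y := fun a y => by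
    have := (hd (a - y)).comp y ((hasDerivAt_id y).const_sub a)
    exact this.congr_deriv (by simp)
  set Φ' : ℝ → ℝ → ℝ := fun τ x => ∫ y, f τ y * deriv ζ (x - y) with hΦ'
  have hΦd : ∀ τ ∈ Icc 0 t₀, ∀ x, HasDerivAt (fun x => ∫ y, f τ y * ζ (x - y)) (Φ' τ x) x := by
    intro τ hτ x
    exact hζc.hasDerivAt_convolution_right (ContinuousLinearMap.mul ℝ ℝ)
      (hft τ hτ).locallyIntegrable (hζ.of_le (by simp)) x
  -- The substitution `z = x - y` moves the dependence on `(τ, x)` from the kernel onto the jointly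
  -- continuous `f`, so dominated convergence applies.
  have hΦc : Tendsto (fun p : ℝ × ℝ => Φ' p.1 p.2) (𝓝 t ×ˢ 𝓝 (X t)) (𝓝 (Φ' t (X t))) := by
    rw [← nhds_prod_eq]
    have e : ∀ p : ℝ × ℝ, Φ' p.1 p.2 = ∫ z, f p.1 (p.2 - z) * deriv ζ z := fun p => by
      simp only [hΦ']
      rw [← integral_sub_left_eq_self _ volume p.2]
      simp
    simp only [e]
    rw [show Φ' t (X t) = ∫ z, f t (X t - z) * deriv ζ z from e (t, X t)]
    have hev : ∀ᶠ p : ℝ × ℝ in 𝓝 (t, X t), p.1 ∈ Icc 0 t₀ :=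
      continuousAt_fst.eventually hnhds
    refine continuousAt_of_dominated (x₀ := (t, X t))
      (F := fun (p : ℝ × ℝ) z => f p.1 (p.2 - z) * deriv ζ z)
      (bound := fun z => F * |deriv ζ z|) ?_ ?_ ?_ ?_
    · filter_upwards [hev] with p hp
      exact (((hft p.1 hp).comp (by fun_prop)).mul hζ').aestronglyMeasurable
    · filter_upwards [hev] with p hp
      refine Eventually.of_forall fun z => ?_
      rw [norm_mul, Real.norm_eq_abs, Real.norm_eq_abs]
      exact mul_le_mul_of_nonneg_right (hF _ hp _) (abs_nonneg _)
    · exact ((hζ'.integrable_of_hasCompactSupport hζ'c).abs).const_mul F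
    · refine Eventually.of_forall fun z => ContinuousAt.mul ?_ continuousAt_const
      have h1 : ContinuousAt (Function.uncurry f) (t, X t - z) :=
        hf.continuousAt (prod_mem_nhds hnhds univ_mem)
      exact ContinuousAt.comp (f := fun p : ℝ × ℝ => (p.1, p.2 - z)) (x := (t, X t)) h1
        (by fun_prop)
  -- The derivative is split in two: here only the centre of the kernel moves, and in `hpart2` the
  -- kernel is frozen at time `t`, hence an admissible test function.
  have hpart1 : HasDerivAt (fun τ => (∫ y, f τ y * ζ (X τ - y)) - ∫ y, f τ y * ζ (X t - y))
      (b t (X t) * Φ' t (X t)) t := by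
    rw [hasDerivAt_iff_isLittleO]
    have hXc := hX.continuousAt
    have h1 := isLittleO_sub_sub_of_tendsto_deriv
      (Filter.mem_of_superset hnhds fun τ hτ => hΦd τ hτ) hΦc hXc.tendsto
    have h2 : (fun τ => X τ - X t) =O[𝓝 t] fun τ => τ - t := hX.isBigO_sub
    have h4 := (hasDerivAt_iff_isLittleO.1 hX).const_mul_left (Φ' t (X t))
    refine ((h1.trans_isBigO h2).add h4).congr' (Eventually.of_forall fun τ => ?_) EventuallyEq.rfl
    simp only [smul_eq_mul]
    ring
  have hpart2 := heq (fun y => ζ (X t - y)) (hζ.comp (contDiff_const.sub contDiff_id))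
    (hrefl hζc (X t))
  have hsum := hpart1.add hpart2
  have hζa : Continuous fun y => ζ (X t - y) := hζ.continuous.comp (by fun_prop)
  have hζ'a : Continuous fun y => deriv ζ (X t - y) := hζ'.comp (by fun_prop)
  have i1 : Integrable (fun y => b t (X t) * (f t y * deriv ζ (X t - y))) volume :=
    Continuous.integrable_of_hasCompactSupport
      (continuous_const.mul ((hft t htI).mul hζ'a)) ((hrefl hζ'c (X t)).mul_left.mul_left)
  have hprod : ∀ y, deriv (fun y => b t y * ζ (X t - y)) y
      = bx t y * ζ (X t - y) - b t y * deriv ζ (X t - y) := fun y => by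
    have := ((hb t htI y).mul (hreflD (X t) y)).deriv
    exact this.trans (by ring)
  have i2 : Integrable (fun y => f t y * deriv (fun y => b t y * ζ (X t - y)) y
      + G t y * ζ (X t - y)) volume := by
    simp only [hprod, mul_sub]
    refine Integrable.add (Integrable.sub ?_ ?_) ?_
    · exact Continuous.integrable_of_hasCompactSupport
        ((hft t htI).mul ((hbx t htI).mul hζa)) ((hrefl hζc (X t)).mul_left.mul_left)
    · exact Continuous.integrable_of_hasCompactSupport
        ((hft t htI).mul (hbc.mul hζ'a)) ((hrefl hζ'c (X t)).mul_left.mul_left)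
    · exact Continuous.integrable_of_hasCompactSupport
        ((hG t htI).mul hζa) ((hrefl hζc (X t)).mul_left)
  refine (hsum.congr_deriv ?_).congr_of_eventuallyEq (Eventually.of_forall fun τ => ?_)
  · simp only [hΦ']
    rw [← integral_const_mul, ← integral_add i1 i2]
    refine integral_congr_ae (Eventually.of_forall fun y => ?_)
    simp only [hprod]
    ring
  · simp

theorem integral_eq_mul_integral_comp_sub_mul (h : ℝ → ℝ) (a : ℝ) {ε : ℝ} (hε : 0 < ε) :
    ∫ y, h y = ∫ z, ε * h (a - ε * z) := by
  rw [integral_const_mul]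
  have h1 := Measure.integral_comp_mul_left (fun y => h (a - y)) ε
  rw [h1, integral_sub_left_eq_self, abs_of_pos (inv_pos.2 hε), smul_eq_mul, ← mul_assoc,
    mul_inv_cancel₀ hε.ne', one_mul]

/-- This identity makes the two parts of the mollification commutator cancel in the limit. -/
theorem integral_mul_deriv_eq_neg_integral {η : ℝ → ℝ} (hη : ContDiff ℝ ∞ η)
    (hηc : HasCompactSupport η) : ∫ z, z * deriv η z = -∫ z, η z := by
  have hη' : Continuous (deriv η) := hη.continuous_deriv (by simp)
  have := integral_mul_deriv_eq_deriv_mul_of_integrable (u := fun z : ℝ => z) (v := η)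
    (u' := fun _ => 1) (v' := deriv η) (fun x _ => hasDerivAt_id x)
    (fun x _ => (hη.differentiable (by simp) x).hasDerivAt)
    ((continuous_id.mul hη').integrable_of_hasCompactSupport hηc.deriv.mul_left)
    ((continuous_const.mul hη.continuous).integrable_of_hasCompactSupport hηc.mul_left)
    ((continuous_id.mul hη.continuous).integrable_of_hasCompactSupport hηc.mul_left)
  simpa using this

/-- A bounded continuous weak solution of the transport equation `f_t + b f_x = G` satisfies
the equation in integrated form along every characteristic. -/
theorem sub_eq_integral_along_characteristic {t₀ F L E : ℝ} (ht₀ : 0 < t₀)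
    {f b bx G : ℝ → ℝ → ℝ} {X : ℝ → ℝ}
    (hf : ContinuousOn (Function.uncurry f) (Icc 0 t₀ ×ˢ univ))
    (hF : ∀ s ∈ Icc 0 t₀, ∀ x, |f s x| ≤ F)
    (hb : ∀ s ∈ Icc 0 t₀, ∀ x, HasDerivAt (b s) (bx s x) x)
    (hbx : ∀ s ∈ Icc 0 t₀, Continuous (bx s))
    (hL : ∀ s ∈ Icc 0 t₀, ∀ x, |bx s x| ≤ L)
    (hG : ∀ s ∈ Icc 0 t₀, Continuous (G s))
    (hE : ∀ s ∈ Icc 0 t₀, ∀ x, |G s x| ≤ E)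
    (heq : ∀ ζ : ℝ → ℝ, ContDiff ℝ ∞ ζ → HasCompactSupport ζ → ∀ t ∈ Ioo 0 t₀,
      HasDerivAt (fun τ => ∫ x, f τ x * ζ x)
        (∫ x, (f t x * deriv (fun y => b t y * ζ y) x + G t x * ζ x)) t)
    (hXc : ContinuousOn X (Icc 0 t₀))
    (hX : ∀ t ∈ Ioo 0 t₀, HasDerivAt X (b t (X t)) t) :
    f t₀ (X t₀) - f 0 (X 0) = ∫ s in (0)..t₀, G s (X s) := by
  have hft : ∀ s ∈ Icc 0 t₀, Continuous (f s) := fun s hs =>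
    hf.comp_continuous (f := fun x => (s, x)) (by fun_prop) fun x => ⟨hs, mem_univ _⟩
  have hbc : ∀ s ∈ Icc 0 t₀, Continuous (b s) := fun s hs =>
    continuous_iff_continuousAt.2 fun x => (hb s hs x).continuousAt
  have hF0 : 0 ≤ F := (abs_nonneg _).trans (hF 0 ⟨le_rfl, ht₀.le⟩ 0)
  have hL0 : 0 ≤ L := (abs_nonneg _).trans (hL 0 ⟨le_rfl, ht₀.le⟩ 0)
  have hLip : ∀ s ∈ Icc 0 t₀, ∀ x y, |b s x - b s y| ≤ L * |x - y| := fun s hs x y =>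
    convex_univ.norm_image_sub_le_of_norm_hasDerivWithin_le (f := b s) (f' := bx s)
      (fun z _ => (hb s hs z).hasDerivWithinAt) (fun z _ => hL s hs z) (mem_univ y) (mem_univ x)
  let bump : ContDiffBump (0 : ℝ) := ⟨1, 2, one_pos, one_lt_two⟩
  obtain ⟨η, hη, hηc, hη1⟩ : ∃ η : ℝ → ℝ, ContDiff ℝ ∞ η ∧ HasCompactSupport η ∧ ∫ z, η z = 1 :=
    ⟨bump.normed volume, bump.contDiff_normed, bump.hasCompactSupport_normed,
      bump.integral_normed⟩
  have hη0 : Continuous η := hη.continuous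
  have hη' : Continuous (deriv η) := hη.continuous_deriv (by simp)
  have hη'c : HasCompactSupport (deriv η) := hηc.deriv
  have hηi : Integrable η volume := hη0.integrable_of_hasCompactSupport hηc
  have hzη'i : Integrable (fun z => z * deriv η z) volume :=
    (continuous_id.mul hη').integrable_of_hasCompactSupport hη'c.mul_left
  -- `Y ε` is the average of `f` at scale `ε` around the characteristic, and `R ε` is its time
  -- derivative. In the latter, the Lipschitz bound on `b` controls the difference quotient, so `bd`
  -- dominates the integrand uniformly in `ε`.
  set Y : ℝ → ℝ → ℝ := fun ε τ => ∫ z, f τ (X τ - ε * z) * η z with hY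
  set r : ℝ → ℝ → ℝ → ℝ := fun ε t z =>
    f t (X t - ε * z) * (bx t (X t - ε * z) * η z
      - (b t (X t - ε * z) - b t (X t)) * ε⁻¹ * deriv η z) + G t (X t - ε * z) * η z with hr
  set R : ℝ → ℝ → ℝ := fun ε t => ∫ z, r ε t z with hR
  set bd : ℝ → ℝ := fun z => F * (L * |η z| + L * |z * deriv η z|) + E * |η z| with hbd
  have hbdi : Integrable bd volume :=
    (((hηi.abs.const_mul L).add (hzη'i.abs.const_mul L)).const_mul F).add (hηi.abs.const_mul E)
  have hrbd : ∀ ε > 0, ∀ t ∈ Icc 0 t₀, ∀ z, ‖r ε t z‖ ≤ bd z := by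
    intro ε hε t ht z
    have h1 : |(b t (X t - ε * z) - b t (X t)) * ε⁻¹ * deriv η z| ≤ L * |z * deriv η z| := by
      have := hLip t ht (X t - ε * z) (X t)
      rw [abs_mul, abs_mul, abs_mul, ← mul_assoc, abs_of_pos (inv_pos.2 hε)]
      refine mul_le_mul_of_nonneg_right ?_ (abs_nonneg _)
      rw [← div_eq_mul_inv, div_le_iff₀ hε]
      refine this.trans (le_of_eq ?_)
      rw [sub_sub_cancel_left, abs_neg, abs_mul, abs_of_pos hε]; ring
    rw [Real.norm_eq_abs]
    refine (abs_add_le _ _).trans (add_le_add ?_ ?_)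
    · rw [abs_mul]
      refine mul_le_mul (hF t ht _) ((abs_sub _ _).trans (add_le_add ?_ h1)) (abs_nonneg _) hF0
      rw [abs_mul]
      exact mul_le_mul_of_nonneg_right (hL t ht _) (abs_nonneg _)
    · rw [abs_mul]
      exact mul_le_mul_of_nonneg_right (hE t ht _) (abs_nonneg _)
  have hrm : ∀ ε, ∀ t ∈ Icc 0 t₀, AEStronglyMeasurable (r ε t) volume := by
    intro ε t ht
    have e : Continuous fun z => X t - ε * z := by fun_prop
    exact ((((hft t ht).comp e).mul ((((hbx t ht).comp e).mul hη0).sub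
      (((((hbc t ht).comp e).sub continuous_const).mul continuous_const).mul hη'))).add
      (((hG t ht).comp e).mul hη0)).aestronglyMeasurable
  have hYd : ∀ ε > 0, ∀ t ∈ Ioo 0 t₀, HasDerivAt (Y ε) (R ε t) t := by
    intro ε hε t ht
    -- The derivative of the rescaled kernel carries `ε⁻²`; the substitution `y = X t - ε z` absorbs
    -- one power and the other forms the difference quotient of `b`.
    set ζ : ℝ → ℝ := fun x => ε⁻¹ * η (ε⁻¹ * x) with hζdef
    have hζ : ContDiff ℝ ∞ ζ := contDiff_const.mul (hη.comp (contDiff_const.mul contDiff_id))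
    have hζc : HasCompactSupport ζ :=
      (hηc.comp_homeomorph (Homeomorph.mulLeft₀ ε⁻¹ (inv_ne_zero hε.ne'))).mul_left
    have hζ' : ∀ x, deriv ζ x = ε⁻¹ * (ε⁻¹ * deriv η (ε⁻¹ * x)) := fun x => by
      have h1 := (hη.differentiable (by simp) (ε⁻¹ * x)).hasDerivAt
      have h2 := (h1.comp x ((hasDerivAt_id x).const_mul ε⁻¹)).const_mul ε⁻¹
      exact (h2.congr_deriv (by ring)).deriv
    have hsc : ∀ z, ε⁻¹ * (ε * z) = z := fun z => by field_simp
    have key := hasDerivAt_integral_mul_kernel hf hF hb hbx hG ht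
      (fun ζ h1 h2 => heq ζ h1 h2 t ht) (hX t ht) hζ hζc
    refine (key.congr_deriv ?_).congr_of_eventuallyEq (Eventually.of_forall fun τ => ?_)
    · rw [integral_eq_mul_integral_comp_sub_mul _ (X t) hε]
      refine integral_congr_ae (Eventually.of_forall fun z => ?_)
      simp only [hr, hζ', sub_sub_cancel, hsc]
      simp only [hζdef, hsc]
      field_simp
    · change ∫ z, _ = ∫ y, _
      rw [integral_eq_mul_integral_comp_sub_mul (fun y => f τ y * ζ (X τ - y)) (X τ) hε]
      refine integral_congr_ae (Eventually.of_forall fun z => ?_)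
      simp only [hζdef, sub_sub_cancel, hsc]
      field_simp
  have hFη : ∀ ε, ∀ t ∈ Icc 0 t₀, ∀ z, ‖f t (X t - ε * z) * η z‖ ≤ F * |η z| := by
    intro ε t ht z
    rw [norm_mul]
    exact mul_le_mul_of_nonneg_right (hF t ht _) (abs_nonneg _)
  have hfηm : ∀ ε, ∀ t ∈ Icc 0 t₀,
      AEStronglyMeasurable (fun z => f t (X t - ε * z) * η z) volume := fun ε t ht =>
    (((hft t ht).comp (by fun_prop)).mul hη0).aestronglyMeasurable
  have hYc : ∀ ε, ContinuousOn (Y ε) (Icc 0 t₀) := by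
    intro ε
    refine continuousOn_of_dominated (bound := fun z => F * |η z|) (hfηm ε)
      (fun t ht => Eventually.of_forall (hFη ε t ht)) (hηi.abs.const_mul F)
      (Eventually.of_forall fun z => ContinuousOn.mul ?_ continuousOn_const)
    exact hf.comp (f := fun t => (t, X t - ε * z))
      (continuousOn_id.prodMk (hXc.sub continuousOn_const)) fun t ht => ⟨ht, mem_univ _⟩
  have hRb : ∀ ε > 0, ∀ t ∈ Icc 0 t₀, ‖R ε t‖ ≤ ∫ z, bd z := fun ε hε t ht =>
    norm_integral_le_of_norm_le hbdi (Eventually.of_forall (hrbd ε hε t ht))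
  have hRm : ∀ ε > 0, AEStronglyMeasurable (R ε) (volume.restrict (uIoc 0 t₀)) := by
    intro ε hε
    -- Measurability in time costs nothing: `R ε` is a derivative on the open interval.
    refine (measurable_deriv (Y ε)).aestronglyMeasurable.congr ?_
    rw [uIoc_of_le ht₀.le, ← restrict_Ioo_eq_restrict_Ioc]
    exact (ae_restrict_mem measurableSet_Ioo).mono fun t ht => (hYd ε hε t ht).deriv
  have hRi : ∀ ε > 0, IntervalIntegrable (R ε) volume 0 t₀ := by
    intro ε hε
    rw [intervalIntegrable_iff]
    have : IsFiniteMeasure (volume.restrict (uIoc 0 t₀)) := by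
      rw [uIoc_of_le ht₀.le]; infer_instance
    refine Integrable.of_bound (hRm ε hε) (∫ z, bd z) ?_
    refine (ae_restrict_mem measurableSet_uIoc).mono fun t ht => ?_
    rw [uIoc_of_le ht₀.le] at ht
    exact hRb ε hε t (Ioc_subset_Icc_self ht)
  have hFTC : ∀ ε > 0, ∫ s in (0)..t₀, R ε s = Y ε t₀ - Y ε 0 := fun ε hε =>
    intervalIntegral.integral_eq_sub_of_hasDerivAt_of_le ht₀.le (hYc ε) (hYd ε hε) (hRi ε hε)
  have hpos : ∀ᶠ ε : ℝ in 𝓝[>] 0, 0 < ε := eventually_mem_nhdsWithin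
  have hshift : ∀ x z : ℝ, Tendsto (fun ε : ℝ => x - ε * z) (𝓝[>] 0) (𝓝 x) := fun x z => by
    have : Tendsto (fun ε : ℝ => x - ε * z) (𝓝 0) (𝓝 (x - 0 * z)) :=
      (by fun_prop : Continuous fun ε : ℝ => x - ε * z).tendsto 0
    simpa using this.mono_left nhdsWithin_le_nhds
  have hYlim : ∀ t ∈ Icc 0 t₀, Tendsto (fun ε => Y ε t) (𝓝[>] 0) (𝓝 (f t (X t))) := by
    intro t ht
    have h1 : Tendsto (fun ε => Y ε t) (𝓝[>] 0) (𝓝 (∫ z, f t (X t) * η z)) := by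
      refine tendsto_integral_filter_of_dominated_convergence (fun z => F * |η z|)
        (Eventually.of_forall fun ε => hfηm ε t ht)
        (Eventually.of_forall fun ε => Eventually.of_forall (hFη ε t ht)) (hηi.abs.const_mul F)
        (Eventually.of_forall fun z => ?_)
      exact (((hft t ht).tendsto _).comp (hshift _ z)).mul_const _
    rwa [integral_const_mul, hη1, mul_one] at h1
  have hRlim : ∀ t ∈ Icc 0 t₀, Tendsto (fun ε => R ε t) (𝓝[>] 0) (𝓝 (G t (X t))) := by
    intro t ht
    have h1 : Tendsto (fun ε => R ε t) (𝓝[>] 0)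
        (𝓝 (∫ z, (f t (X t) * (bx t (X t) * η z + bx t (X t) * (z * deriv η z))
          + G t (X t) * η z))) := by
      refine tendsto_integral_filter_of_dominated_convergence bd
        (Eventually.of_forall fun ε => hrm ε t ht)
        (hpos.mono fun ε hε => Eventually.of_forall (hrbd ε hε t ht)) hbdi
        (Eventually.of_forall fun z => ?_)
      have hdiff : Tendsto (fun ε => (b t (X t - ε * z) - b t (X t)) * ε⁻¹) (𝓝[>] 0)
          (𝓝 (-(bx t (X t) * z))) := by
        have h2 : HasDerivAt (fun ε => b t (X t - ε * z)) (bx t (X t) * -z) 0 := by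
          have h3 : HasDerivAt (b t) (bx t (X t)) (X t - 0 * z) := by simpa using hb t ht (X t)
          have h4 : HasDerivAt (fun ε : ℝ => X t - ε * z) (-z) 0 := by
            simpa using ((hasDerivAt_id (0 : ℝ)).mul_const z).const_sub (X t)
          exact h3.comp 0 h4
        have h5 := h2.tendsto_slope_zero_right
        refine (h5.congr fun ε => ?_).trans (by simp)
        simp [mul_comm]
      have hsub := (((hft t ht).tendsto _).comp (hshift (X t) z)).mul
        (((((hbx t ht).tendsto _).comp (hshift (X t) z)).mul_const (η z)).sub
          (hdiff.mul_const (deriv η z)))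
      have := hsub.add ((((hG t ht).tendsto _).comp (hshift (X t) z)).mul_const (η z))
      refine this.trans (le_of_eq ?_)
      congr 1
      ring
    have i1 : Integrable (fun z => bx t (X t) * η z + bx t (X t) * (z * deriv η z)) volume :=
      (hηi.const_mul _).add (hzη'i.const_mul _)
    -- Since `∫ η = 1` and `∫ z η' = -1`, the two terms with `bx` cancel and only `G` survives.
    rw [integral_add (i1.const_mul _) (hηi.const_mul _),
      integral_const_mul, integral_add (hηi.const_mul _) (hzη'i.const_mul _), integral_const_mul,
      integral_const_mul, integral_const_mul, integral_mul_deriv_eq_neg_integral hη hηc, hη1] at h1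
    simpa using h1
  have hlim1 : Tendsto (fun ε => ∫ s in (0)..t₀, R ε s) (𝓝[>] 0)
      (𝓝 (∫ s in (0)..t₀, G s (X s))) := by
    refine intervalIntegral.tendsto_integral_filter_of_dominated_convergence
      (fun _ => ∫ z, bd z) (hpos.mono hRm) (hpos.mono fun ε hε => Eventually.of_forall
        fun t ht => ?_) (by simp) (Eventually.of_forall fun t ht => ?_)
    · rw [uIoc_of_le ht₀.le] at ht
      exact hRb ε hε t (Ioc_subset_Icc_self ht)
    · rw [uIoc_of_le ht₀.le] at ht
      exact hRlim t (Ioc_subset_Icc_self ht)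
  have hlim2 := (hYlim t₀ ⟨ht₀.le, le_rfl⟩).sub (hYlim 0 ⟨le_rfl, ht₀.le⟩)
  exact tendsto_nhds_unique (hlim2.congr' (hpos.mono fun ε hε => (hFTC ε hε).symm)) hlim1

/-! ### Characteristics and propagation of the weight -/

/-- Backward characteristics of a bounded vector field that is globally Lipschitz in space. -/
theorem exists_characteristic {t B L : ℝ} (ht : 0 < t) {b bx : ℝ → ℝ → ℝ}
    (hbc : ContinuousOn (Function.uncurry b) (Icc 0 t ×ˢ univ))
    (hB : ∀ s ∈ Icc 0 t, ∀ x, |b s x| ≤ B)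
    (hb : ∀ s ∈ Icc 0 t, ∀ x, HasDerivAt (b s) (bx s x) x)
    (hL : ∀ s ∈ Icc 0 t, ∀ x, |bx s x| ≤ L) (x : ℝ) :
    ∃ X : ℝ → ℝ, X t = x ∧ (∀ s ∈ Icc 0 t, HasDerivWithinAt X (b s (X s)) (Icc 0 t) s) ∧
      ∀ s ∈ Icc 0 t, |X s - x| ≤ B * t := by
  have h0 : (0 : ℝ) ∈ Icc 0 t := ⟨le_rfl, ht.le⟩
  have hB0 : 0 ≤ B := (abs_nonneg _).trans (hB 0 h0 0)
  have hL0 : 0 ≤ L := (abs_nonneg _).trans (hL 0 h0 0)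
  -- A ball of radius `B t` cannot be left within time `t`, so a single application covers all of
  -- `[0, t]`.
  have hPL : IsPicardLindelof b (⟨t, ht.le, le_rfl⟩ : Icc (0 : ℝ) t) x
      (⟨B * t, by positivity⟩ : ℝ≥0) 0 ⟨B, hB0⟩ ⟨L, hL0⟩ := by
    refine ⟨fun s hs => ?_, fun y _ => ?_, fun s hs y _ => hB s hs y, ?_⟩
    · refine LipschitzOnWith.of_dist_le_mul fun y _ z _ => ?_
      rw [Real.dist_eq, Real.dist_eq]
      exact convex_univ.norm_image_sub_le_of_norm_hasDerivWithin_le (f := b s) (f' := bx s)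
        (fun z _ => (hb s hs z).hasDerivWithinAt) (fun z _ => hL s hs z) (mem_univ z) (mem_univ y)
    · exact hbc.comp (f := fun s => (s, y)) (by fun_prop) fun s hs => ⟨hs, mem_univ _⟩
    · simp only [sub_self, sub_zero, max_eq_right ht.le, NNReal.coe_zero]
      exact le_rfl
  obtain ⟨X, hXt, hX⟩ := hPL.exists_eq_forall_mem_Icc_hasDerivWithinAt₀
  refine ⟨X, hXt, hX, fun s hs => ?_⟩
  have := (convex_Icc 0 t).norm_image_sub_le_of_norm_hasDerivWithin_le hX
    (fun s hs => hB s hs (X s)) (⟨ht.le, le_rfl⟩ : t ∈ Icc 0 t) hs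
  rw [show X t = x from hXt, Real.norm_eq_abs, Real.norm_eq_abs] at this
  refine this.trans (mul_le_mul_of_nonneg_left ?_ hB0)
  rw [abs_sub_comm, abs_of_nonneg (sub_nonneg.2 hs.2)]
  linarith [hs.1]

/-- `w` is jointly continuous on `[0, T₀] × ℝ` and bounded there by `P`. -/
structure IsBddCont (T₀ P : ℝ) (w : ℝ → ℝ → ℝ) : Prop where
  continuousOn : ContinuousOn (Function.uncurry w) (Icc 0 T₀ ×ˢ univ)
  bound : ∀ t ∈ Icc 0 T₀, ∀ x, |w t x| ≤ P

namespace IsBddCont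

variable {T₀ P Q : ℝ} {w z : ℝ → ℝ → ℝ}

theorem add (hw : IsBddCont T₀ P w) (hz : IsBddCont T₀ Q z) :
    IsBddCont T₀ (P + Q) fun t x => w t x + z t x :=
  ⟨hw.continuousOn.add hz.continuousOn, fun t ht x =>
    (abs_add_le _ _).trans (add_le_add (hw.bound t ht x) (hz.bound t ht x))⟩

theorem sub (hw : IsBddCont T₀ P w) (hz : IsBddCont T₀ Q z) :
    IsBddCont T₀ (P + Q) fun t x => w t x - z t x :=
  ⟨hw.continuousOn.sub hz.continuousOn, fun t ht x =>
    (abs_sub _ _).trans (add_le_add (hw.bound t ht x) (hz.bound t ht x))⟩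

theorem mul (hw : IsBddCont T₀ P w) (hz : IsBddCont T₀ Q z) :
    IsBddCont T₀ (P * Q) fun t x => w t x * z t x :=
  ⟨hw.continuousOn.mul hz.continuousOn, fun t ht x => by
    rw [abs_mul]
    exact mul_le_mul (hw.bound t ht x) (hz.bound t ht x) (abs_nonneg _)
      ((abs_nonneg _).trans (hw.bound t ht x))⟩

theorem const_mul (c : ℝ) (hw : IsBddCont T₀ P w) :
    IsBddCont T₀ (|c| * P) fun t x => c * w t x :=
  ⟨continuousOn_const.mul hw.continuousOn, fun t ht x => by
    rw [abs_mul]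
    exact mul_le_mul_of_nonneg_left (hw.bound t ht x) (abs_nonneg _)⟩

theorem continuous (hw : IsBddCont T₀ P w) {t : ℝ} (ht : t ∈ Icc 0 T₀) : Continuous (w t) :=
  hw.continuousOn.comp_continuous (f := fun x => (t, x)) (by fun_prop) fun x => ⟨ht, mem_univ _⟩

end IsBddCont

/-- Persistence of the logarithmic weight for bounded weak solutions of a transport equation. -/
theorem weighted_bound_of_transport {β T₀ F L B E A K : ℝ} (hβ : 0 < β) (hT₁ : T₀ ≤ 1)
    {f b bx G : ℝ → ℝ → ℝ}
    (hf : IsBddCont T₀ F f) (hbb : IsBddCont T₀ B b) (hbx : IsBddCont T₀ L bx)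
    (hG : IsBddCont T₀ E G)
    (hb : ∀ s ∈ Icc 0 T₀, ∀ x, HasDerivAt (b s) (bx s x) x)
    (heq : ∀ ζ : ℝ → ℝ, ContDiff ℝ ∞ ζ → HasCompactSupport ζ → ∀ t ∈ Ioo 0 T₀,
      HasDerivAt (fun τ => ∫ x, f τ x * ζ x)
        (∫ x, (f t x * deriv (fun y => b t y * ζ y) x + G t x * ζ x)) t)
    (hA : 1 ≤ A)
    (hGA : ∀ s ∈ Icc 0 T₀, ∀ x, |G s x| * logWeight β x ≤ A * (|f s x| * logWeight β x) + K)
    (h0 : ∀ x, |f 0 x| * logWeight β x ≤ K) :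
    ∀ t ∈ Icc 0 T₀, ∀ x,
      |f t x| * logWeight β x ≤ 2 * weightConst β * Real.exp (B / 2) * Real.exp A * K := by
  intro t htT x
  have hφ := logWeight_pos hβ
  have hc := one_le_weightConst hβ
  have hK : 0 ≤ K := (mul_nonneg (abs_nonneg _) (hφ 0).le).trans (h0 0)
  have hB0 : 0 ≤ B := (abs_nonneg _).trans (hbb.bound t htT 0)
  rcases htT.1.eq_or_lt with rfl | ht
  · refine (h0 x).trans (le_mul_of_one_le_left hK ?_)
    have h1 := Real.one_le_exp (show 0 ≤ B / 2 by linarith)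
    have h2 := Real.one_le_exp (show 0 ≤ A by linarith)
    have h3 : 1 ≤ 2 * weightConst β := by linarith
    exact one_le_mul_of_one_le_of_one_le (one_le_mul_of_one_le_of_one_le h3 h1) h2
  have hsub : Icc 0 t ⊆ Icc 0 T₀ := Icc_subset_Icc_right htT.2
  have hsub2 : Icc 0 t ×ˢ (univ : Set ℝ) ⊆ Icc 0 T₀ ×ˢ univ := prod_mono hsub subset_rfl
  obtain ⟨X, hXt, hX, hXx⟩ := exists_characteristic ht (hbb.continuousOn.mono hsub2)
    (fun s hs => hbb.bound s (hsub hs)) (fun s hs => hb s (hsub hs)) (fun s hs => hbx.bound s (hsub hs)) x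
  have hXc : ContinuousOn X (Icc 0 t) := fun s hs => (hX s hs).continuousWithinAt
  have hcurve : ∀ {g : ℝ → ℝ → ℝ}, ContinuousOn (Function.uncurry g) (Icc 0 T₀ ×ˢ univ) →
      ContinuousOn (fun s => g s (X s)) (Icc 0 t) := fun {g} hg =>
    hg.comp (f := fun s => (s, X s)) (continuousOn_id.prodMk hXc) fun s hs => ⟨hsub hs, mem_univ _⟩
  have hint : ∀ s ∈ Icc 0 t, f s (X s) = f 0 (X 0) + ∫ τ in (0)..s, G τ (X τ) := by
    intro s hs
    rcases hs.1.eq_or_lt with rfl | hs0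
    · simp
    have hss : Icc 0 s ⊆ Icc 0 t := Icc_subset_Icc_right hs.2
    have hss2 : Icc 0 s ⊆ Icc 0 T₀ := hss.trans hsub
    have : f s (X s) - f 0 (X 0) = ∫ τ in (0)..s, G τ (X τ) :=
      sub_eq_integral_along_characteristic hs0
      (hf.continuousOn.mono (prod_mono hss2 subset_rfl)) (fun τ hτ => hf.bound τ (hss2 hτ))
      (fun τ hτ => hb τ (hss2 hτ)) (fun τ hτ => hbx.continuous (hss2 hτ)) (fun τ hτ => hbx.bound τ (hss2 hτ))
      (fun τ hτ => hG.continuous (hss2 hτ))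
      (fun τ hτ => hG.bound τ (hss2 hτ))
      (fun ζ h1 h2 τ hτ => heq ζ h1 h2 τ ⟨hτ.1, hτ.2.trans_le (hs.2.trans htT.2)⟩)
      (hXc.mono hss) (fun τ hτ => (hX τ (hss (Ioo_subset_Icc_self hτ))).hasDerivAt
        (Icc_mem_nhds hτ.1 (hτ.2.trans_le hs.2)))
    linarith
  -- Since `|X s - x| ≤ B`, the weight at `X s` is comparable with the weight at `x`. Gronwall's
  -- inequality can therefore be run for `|f|` itself, with the weight frozen at the endpoint.
  set D := weightConst β * Real.exp (B / 2) * K / logWeight β x with hD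
  have hw : ∀ s ∈ Icc 0 t, K / logWeight β (X s) ≤ D := by
    intro s hs
    rw [hD, div_le_div_iff₀ (hφ _) (hφ _)]
    have h1 := logWeight_le hβ x (X s)
    have h2 : |x - X s| / 2 ≤ B / 2 := by
      have h3 := hXx s hs
      rw [abs_sub_comm] at h3
      have h4 : B * t ≤ B := mul_le_of_le_one_right hB0 (htT.2.trans hT₁)
      linarith
    calc K * logWeight β x
        ≤ K * (weightConst β * Real.exp (B / 2) * logWeight β (X s)) := by
          refine mul_le_mul_of_nonneg_left (h1.trans ?_) hK
          have := (hφ (X s)).le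
          gcongr
      _ = _ := by ring
  -- Clamping time to `[0, t]` extends the source continuously to the whole line, so its primitive
  -- `y` is differentiable everywhere, endpoints included.
  set p : ℝ → ℝ := fun s => projIcc 0 t ht.le s with hp
  have hpc : Continuous p := continuous_subtype_val.comp continuous_projIcc
  have hpm : ∀ s, p s ∈ Icc 0 t := fun s => (projIcc 0 t ht.le s).2
  have hpe : ∀ s ∈ Icc 0 t, p s = s := fun s hs => by simp only [hp, projIcc_of_mem ht.le hs]
  set g : ℝ → ℝ := fun s => G (p s) (X (p s)) with hg
  have hgc : Continuous g := (hcurve hG.continuousOn).comp_continuous hpc hpm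
  set y : ℝ → ℝ := fun s => f 0 (X 0) + ∫ τ in (0)..s, g τ with hy
  have hyd : ∀ s, HasDerivAt y (g s) s := fun s =>
    (intervalIntegral.integral_hasDerivAt_right (hgc.intervalIntegrable _ _)
      hgc.stronglyMeasurable.stronglyMeasurableAtFilter hgc.continuousAt).const_add _
  have hye : ∀ s ∈ Icc 0 t, y s = f s (X s) := by
    intro s hs
    rw [hint s hs]
    simp only [hy]
    congr 1
    refine intervalIntegral.integral_congr fun τ hτ => ?_
    rw [uIcc_of_le hs.1] at hτ
    simp only [hg, hpe τ ⟨hτ.1, hτ.2.trans hs.2⟩]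
  have h0t : (0 : ℝ) ∈ Icc 0 t := ⟨le_rfl, ht.le⟩
  have hgron := norm_le_gronwallBound_of_norm_deriv_right_le (f := y) (f' := g) (δ := D) (K := A)
    (ε := D) (a := 0) (b := t) (fun s _ => (hyd s).continuousAt.continuousWithinAt)
    (fun s _ => (hyd s).hasDerivWithinAt)
    (by
      rw [hye 0 h0t]
      exact ((le_div_iff₀ (hφ _)).2 (h0 (X 0))).trans (hw 0 h0t))
    (fun s hs => by
      have hs' : s ∈ Icc 0 t := ⟨hs.1, hs.2.le⟩
      rw [hye s hs']
      simp only [hg, hpe s hs', Real.norm_eq_abs]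
      have h1 := hGA s (hsub hs') (X s)
      have h2 : |G s (X s)| ≤ A * |f s (X s)| + K / logWeight β (X s) := by
        rw [← mul_le_mul_iff_left₀ (hφ (X s)), add_mul, div_mul_cancel₀ _ (hφ _).ne', mul_assoc]
        exact h1
      exact h2.trans (add_le_add_right (hw s hs') _))
    t ⟨ht.le, le_rfl⟩
  have htt : t ∈ Icc 0 t := ⟨ht.le, le_rfl⟩
  have hA0 : 0 < A := by linarith
  have hD0 : 0 ≤ D := div_nonneg (mul_nonneg (by positivity) hK) (hφ x).le
  rw [hye t htt, hXt, gronwallBound_of_K_ne_0 hA0.ne', Real.norm_eq_abs, sub_zero] at hgron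
  have h1 : Real.exp (A * t) ≤ Real.exp A :=
    Real.exp_le_exp.2 (mul_le_of_le_one_right hA0.le (htT.2.trans hT₁))
  -- The assumption `1 ≤ A` serves to remove the quotient from the Gronwall bound.
  have h2 : D / A ≤ D := div_le_self hD0 hA
  have h3 : 1 ≤ Real.exp (A * t) := Real.one_le_exp (by positivity)
  have h4 : |f t x| ≤ 2 * Real.exp A * D := by
    refine hgron.trans ?_
    have h5 : D / A * (Real.exp (A * t) - 1) ≤ D * Real.exp A :=
      mul_le_mul h2 (by linarith) (by linarith) hD0
    have h6 : D * Real.exp (A * t) ≤ D * Real.exp A := mul_le_mul_of_nonneg_left h1 hD0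
    linarith
  calc |f t x| * logWeight β x ≤ 2 * Real.exp A * D * logWeight β x :=
        mul_le_mul_of_nonneg_right h4 (hφ x).le
    _ = 2 * Real.exp A * (D * logWeight β x) := by ring
    _ = _ := by
        rw [hD, div_mul_cancel₀ _ (hφ x).ne']; ring

/-! ### The persistence estimate for the system -/

/-- The constant in `weighted_bound_of_transport`, for fields bounded by `P`. -/
noncomputable def transportConst (β P K : ℝ) : ℝ :=
  2 * weightConst β * Real.exp (P * P / 2) * Real.exp (4 * P ^ 2) * K

/-- The bound for `ρ` in the persistence estimate. -/
noncomputable def densityConst (β P C₀ : ℝ) : ℝ := transportConst β P C₀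

/-- The bound for `ρ_x` in the persistence estimate. -/
noncomputable def densityDerivConst (β P C₀ : ℝ) : ℝ :=
  transportConst β P (C₀ + 4 * P ^ 2 * densityConst β P C₀)

/-- The bound for `m` and `n` in the persistence estimate. -/
noncomputable def momentumConst (β P C₀ : ℝ) : ℝ :=
  transportConst β P (2 * C₀ + P ^ 2 * densityConst β P C₀)

/-- The bound for all eight components in the persistence estimate. -/
noncomputable def persistenceConst (β P C₀ : ℝ) : ℝ :=
  max (max (densityConst β P C₀) (densityDerivConst β P C₀))
    (6 * weightConst β ^ 2 * momentumConst β P C₀)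

/-- Pointwise bound of the eight components that enter the weighted norm. -/
structure WeightedBound (β C : ℝ) (ρ u v : ℝ → ℝ) : Prop where
  weighted_rho : ∀ x, |ρ x| * logWeight β x ≤ C
  weighted_rho_x : ∀ x, |deriv ρ x| * logWeight β x ≤ C
  weighted_u : ∀ x, |u x| * logWeight β x ≤ C
  weighted_u_x : ∀ x, |deriv u x| * logWeight β x ≤ C
  weighted_u_xx : ∀ x, |iteratedDeriv 2 u x| * logWeight β x ≤ C
  weighted_v : ∀ x, |v x| * logWeight β x ≤ C
  weighted_v_x : ∀ x, |deriv v x| * logWeight β x ≤ C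
  weighted_v_xx : ∀ x, |iteratedDeriv 2 v x| * logWeight β x ≤ C

/-- The persistence estimate for the momentum of one velocity component `w`, which is transported
by `b` and is coupled to the other component through `z`. -/
theorem weighted_bound_velocity {β P T₀ C₀ σ : ℝ} (hβ : 0 < β) (hT₁ : T₀ ≤ 1) (hP : 1 ≤ P)
    (hσ : |σ| = 1) {ρ w z b bx : ℝ → ℝ → ℝ}
    (hw : ∀ t ∈ Icc 0 T₀, ContDiff ℝ 2 (w t))
    (hρb : IsBddCont T₀ P ρ) (hwb : IsBddCont T₀ P w)
    (hwb' : IsBddCont T₀ P fun t => deriv (w t))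
    (hwb'' : IsBddCont T₀ P fun t => iteratedDeriv 2 (w t)) (hzb : IsBddCont T₀ P z)
    (hbb : IsBddCont T₀ (P * P) b) (hbx : IsBddCont T₀ (P * P + P * P) bx)
    (hb : ∀ s ∈ Icc 0 T₀, ∀ x, HasDerivAt (b s) (bx s x) x)
    (heq : ∀ ζ : ℝ → ℝ, ContDiff ℝ ∞ ζ → HasCompactSupport ζ → ∀ t ∈ Ioo 0 T₀,
      HasDerivAt (fun τ => ∫ x, momentum (w τ) x * ζ x)
        (∫ x, (momentum (w t) x * deriv (fun y => b t y * ζ y) x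
          - (3 * z t x * deriv (w t) x * momentum (w t) x + σ * (ρ t x ^ 2 * w t x)) * ζ x)) t)
    (hρ : ∀ t ∈ Icc 0 T₀, ∀ x, |ρ t x| * logWeight β x ≤ densityConst β P C₀)
    (hC₀ : 0 ≤ C₀)
    (h0 : ∀ x, |w 0 x| * logWeight β x ≤ C₀)
    (h0' : ∀ x, |iteratedDeriv 2 (w 0) x| * logWeight β x ≤ C₀) :
    ∀ t ∈ Icc 0 T₀, ∀ x,
      |w t x| * logWeight β x ≤ 6 * weightConst β ^ 2 * momentumConst β P C₀ ∧
      |deriv (w t) x| * logWeight β x ≤ 6 * weightConst β ^ 2 * momentumConst β P C₀ ∧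
      |iteratedDeriv 2 (w t) x| * logWeight β x ≤
        6 * weightConst β ^ 2 * momentumConst β P C₀ := by
  have hφ := logWeight_pos hβ
  have hm : ∀ t ∈ Icc 0 T₀, ∀ x,
      |momentum (w t) x| * logWeight β x ≤ momentumConst β P C₀ := by
    rcases lt_or_ge T₀ 0 with hT | hT
    · intro t ht; exact absurd (ht.1.trans ht.2) (not_le.2 hT)
    have hD : 0 ≤ densityConst β P C₀ :=
      (mul_nonneg (abs_nonneg _) (hφ 0).le).trans (hρ 0 ⟨le_rfl, hT⟩ 0)
    -- The source is linear in `m` with coefficient at most `3 P²`. The coupling term is split as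
    -- `ρ² w = (ρ w) ρ`: one factor `ρ` keeps the weight and the rest is bounded by `P²`. The rate
    -- `4 P²` leaves some slack and is shared with the density estimates.
    refine weighted_bound_of_transport (G := fun t x => (-1) * (3 * (z t x * deriv (w t) x *
        momentum (w t) x) + σ * (ρ t x * ρ t x * w t x))) hβ hT₁ (hwb.sub hwb'') hbb hbx
      (((((hzb.mul hwb').mul (hwb.sub hwb'')).const_mul 3).add
        (((hρb.mul hρb).mul hwb).const_mul σ)).const_mul (-1)) hb ?_ ?_ ?_ ?_
    · intro ζ hζ hζc t ht
      refine (heq ζ hζ hζc t ht).congr_deriv ?_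
      refine integral_congr_ae (Eventually.of_forall fun x => ?_)
      simp only
      ring
    · nlinarith
    · intro t ht x
      have e1 : |z t x * deriv (w t) x| ≤ P * P := (hzb.mul hwb').bound t ht x
      have e2 : |ρ t x * w t x| ≤ P * P := (hρb.mul hwb).bound t ht x
      have e3 : |(-1) * (3 * (z t x * deriv (w t) x *
        momentum (w t) x) + σ * (ρ t x * ρ t x * w t x))| ≤
          3 * (P * P) * |momentum (w t) x| + P * P * |ρ t x| := by
        rw [abs_mul, abs_neg, abs_one, one_mul]
        refine (abs_add_le _ _).trans (add_le_add ?_ ?_)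
        · rw [abs_mul, abs_mul, abs_of_pos (by norm_num : (0 : ℝ) < 3), ← mul_assoc]
          gcongr
        · rw [abs_mul, hσ, one_mul, show ρ t x * ρ t x * w t x = ρ t x * w t x * ρ t x by ring,
            abs_mul]
          gcongr
      have e4 := mul_le_mul_of_nonneg_right e3 (hφ x).le
      have e5 : P * P * (|ρ t x| * logWeight β x) ≤ P * P * densityConst β P C₀ := by
        have := hρ t ht x
        gcongr
      have e6 : 0 ≤ P * P * (|momentum (w t) x| * logWeight β x) :=
        mul_nonneg (by positivity) (mul_nonneg (abs_nonneg _) (hφ x).le)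
      refine e4.trans ?_
      change _ ≤ 4 * P ^ 2 * (|momentum (w t) x| * logWeight β x) + _
      nlinarith
    · intro x
      have e1 : |w 0 x - iteratedDeriv 2 (w 0) x| ≤ |w 0 x| + |iteratedDeriv 2 (w 0) x| :=
        abs_sub _ _
      have e2 := mul_le_mul_of_nonneg_right e1 (hφ x).le
      have e3 : 0 ≤ P ^ 2 * densityConst β P C₀ := by positivity
      have := h0 x
      have := h0' x
      change |w 0 x - iteratedDeriv 2 (w 0) x| * logWeight β x ≤ _
      linarith
  intro t ht x
  have hM : 0 ≤ weightConst β ^ 2 * momentumConst β P C₀ :=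
    mul_nonneg (sq_nonneg _) ((mul_nonneg (abs_nonneg _) (hφ x).le).trans (hm t ht x))
  obtain ⟨h1, h2, h3⟩ := weighted_bound_of_momentum hβ (hw t ht) (hwb.bound t ht)
    (hwb'.bound t ht) (hm t ht) x
  exact ⟨by linarith, by linarith, by linarith⟩

/-- The persistence estimate, for solutions with the regularity that the Sobolev embedding
provides. -/
theorem weightedBound_of_regular {β P T₀ C₀ : ℝ} (hβ : 0 < β) (hT₁ : T₀ ≤ 1) (hP : 1 ≤ P)
    (hC₀ : 0 ≤ C₀) {ρ u v : ℝ → ℝ → ℝ}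
    (hρ : ∀ t ∈ Icc 0 T₀, ContDiff ℝ 1 (ρ t)) (hu : ∀ t ∈ Icc 0 T₀, ContDiff ℝ 2 (u t))
    (hv : ∀ t ∈ Icc 0 T₀, ContDiff ℝ 2 (v t))
    (hρb : IsBddCont T₀ P ρ) (hρb' : IsBddCont T₀ P fun t => deriv (ρ t))
    (hub : IsBddCont T₀ P u) (hub' : IsBddCont T₀ P fun t => deriv (u t))
    (hub'' : IsBddCont T₀ P fun t => iteratedDeriv 2 (u t))
    (hvb : IsBddCont T₀ P v) (hvb' : IsBddCont T₀ P fun t => deriv (v t))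
    (hvb'' : IsBddCont T₀ P fun t => iteratedDeriv 2 (v t))
    (eq_rho : ∀ ζ : ℝ → ℝ, ContDiff ℝ ∞ ζ → HasCompactSupport ζ → ∀ t ∈ Ioo 0 T₀,
      HasDerivAt (fun τ => ∫ x, ρ τ x * ζ x) (∫ x, ρ t x * u t x * v t x * deriv ζ x) t)
    (eq_m : ∀ ζ : ℝ → ℝ, ContDiff ℝ ∞ ζ → HasCompactSupport ζ → ∀ t ∈ Ioo 0 T₀,
      HasDerivAt (fun τ => ∫ x, momentum (u τ) x * ζ x)
        (∫ x, (momentum (u t) x * deriv (fun y => u t y * v t y * ζ y) x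
          - (3 * v t x * deriv (u t) x * momentum (u t) x + ρ t x ^ 2 * u t x) * ζ x)) t)
    (eq_n : ∀ ζ : ℝ → ℝ, ContDiff ℝ ∞ ζ → HasCompactSupport ζ → ∀ t ∈ Ioo 0 T₀,
      HasDerivAt (fun τ => ∫ x, momentum (v τ) x * ζ x)
        (∫ x, (momentum (v t) x * deriv (fun y => u t y * v t y * ζ y) x
          - (3 * u t x * deriv (v t) x * momentum (v t) x - ρ t x ^ 2 * v t x) * ζ x)) t)
    (h0 : WeightedBound β C₀ (ρ 0) (u 0) (v 0)) :
    ∀ t ∈ Icc 0 T₀, WeightedBound β (persistenceConst β P C₀) (ρ t) (u t) (v t) := by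
  have hφ := logWeight_pos hβ
  set b : ℝ → ℝ → ℝ := fun t x => u t x * v t x with hb
  set bx : ℝ → ℝ → ℝ := fun t x => deriv (u t) x * v t x + u t x * deriv (v t) x with hbx
  set bxx : ℝ → ℝ → ℝ := fun t x => (iteratedDeriv 2 (u t) x * v t x
    + deriv (u t) x * deriv (v t) x) + (deriv (u t) x * deriv (v t) x
    + u t x * iteratedDeriv 2 (v t) x) with hbxx
  have hbb : IsBddCont T₀ (P * P) b := hub.mul hvb
  have hbxb : IsBddCont T₀ (P * P + P * P) bx := (hub'.mul hvb).add (hub.mul hvb')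
  have hbxxb : IsBddCont T₀ ((P * P + P * P) + (P * P + P * P)) bxx :=
    ((hub''.mul hvb).add (hub'.mul hvb')).add ((hub'.mul hvb').add (hub.mul hvb''))
  have hud : ∀ t ∈ Icc 0 T₀, ∀ x, HasDerivAt (u t) (deriv (u t) x) x := fun t ht x =>
    ((hu t ht).differentiable (by norm_num) x).hasDerivAt
  have hvd : ∀ t ∈ Icc 0 T₀, ∀ x, HasDerivAt (v t) (deriv (v t) x) x := fun t ht x =>
    ((hv t ht).differentiable (by norm_num) x).hasDerivAt
  have hρd : ∀ t ∈ Icc 0 T₀, ∀ x, HasDerivAt (ρ t) (deriv (ρ t) x) x := fun t ht x =>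
    ((hρ t ht).differentiable (by norm_num) x).hasDerivAt
  have hbd : ∀ t ∈ Icc 0 T₀, ∀ x, HasDerivAt (b t) (bx t x) x := fun t ht x =>
    (hud t ht x).mul (hvd t ht x)
  have hbxd : ∀ t ∈ Icc 0 T₀, ∀ x, HasDerivAt (bx t) (bxx t x) x := fun t ht x =>
    ((hasDerivAt_deriv_of_contDiff_two (hu t ht) x).mul (hvd t ht x)).add
      ((hud t ht x).mul (hasDerivAt_deriv_of_contDiff_two (hv t ht) x))
  have hζd : ∀ {ζ : ℝ → ℝ}, ContDiff ℝ ∞ ζ → ∀ x, HasDerivAt ζ (deriv ζ x) x := fun {ζ} hζ x =>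
    (hζ.differentiable (by simp) x).hasDerivAt
  have hζ' : ∀ {ζ : ℝ → ℝ}, ContDiff ℝ ∞ ζ → ContDiff ℝ ∞ (deriv ζ) := fun {ζ} hζ =>
    (contDiff_infty_iff_deriv.1 hζ).2
  have hbζ : ∀ {ζ : ℝ → ℝ}, ContDiff ℝ ∞ ζ → ∀ t ∈ Icc 0 T₀, ∀ x,
      deriv (fun y => b t y * ζ y) x = bx t x * ζ x + b t x * deriv ζ x := fun {ζ} hζ t ht x =>
    ((hbd t ht x).mul (hζd hζ x)).deriv
  have hA : 1 ≤ 4 * P ^ 2 := by nlinarith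
  have hrho : ∀ t ∈ Icc 0 T₀, ∀ x, |ρ t x| * logWeight β x ≤ densityConst β P C₀ := by
    -- The conservation law in transport form: `ρ_t + b ρ_x = -b_x ρ`.
    refine weighted_bound_of_transport (G := fun t x => (-1) * (bx t x * ρ t x)) hβ hT₁ hρb hbb hbxb
      ((hbxb.mul hρb).const_mul (-1)) hbd ?_ hA ?_ h0.weighted_rho
    · intro ζ hζ hζc t ht
      refine (eq_rho ζ hζ hζc t ht).congr_deriv ?_
      refine integral_congr_ae (Eventually.of_forall fun x => ?_)
      simp only [hbζ hζ t (Ioo_subset_Icc_self ht)]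
      simp only [hb]
      ring
    · intro t ht x
      have e1 := hbxb.bound t ht x
      have e2 : 0 ≤ |ρ t x| * logWeight β x := mul_nonneg (abs_nonneg _) (hφ x).le
      rw [abs_mul, abs_mul, abs_neg, abs_one, one_mul, mul_assoc]
      have e3 := mul_le_mul_of_nonneg_right e1 e2
      nlinarith
  have hD : 0 ≤ densityConst β P C₀ := by
    unfold densityConst transportConst
    have := one_le_weightConst hβ
    positivity
  have hrhox : ∀ t ∈ Icc 0 T₀, ∀ x,
      |deriv (ρ t) x| * logWeight β x ≤ densityDerivConst β P C₀ := by
    -- Formal differentiation gives the source `-(2 b_x ρ_x + b_xx ρ)`. As `|b_x| ≤ 2 P²` and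
    -- `|b_xx| ≤ 4 P²`, both coefficients are at most `4 P²`. The weak form follows by testing the
    -- density equation against `-ζ'`, so `ρ_xx` never appears.
    refine weighted_bound_of_transport (f := fun t => deriv (ρ t))
      (G := fun t x => (-1) * (2 * (bx t x * deriv (ρ t) x) + bxx t x * ρ t x)) hβ hT₁
      hρb' hbb hbxb ((((hbxb.mul hρb').const_mul 2).add (hbxxb.mul hρb)).const_mul (-1)) hbd
      ?_ hA ?_ ?_
    · intro ζ hζ hζc t ht
      have htI := Ioo_subset_Icc_self ht
      have hζ1 := hζ' hζ
      have hζ2 := hζ' hζ1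
      have hζ1c : HasCompactSupport (deriv ζ) := hζc.deriv
      have hζ2c : HasCompactSupport (deriv (deriv ζ)) := hζ1c.deriv
      have hparts : ∀ τ ∈ Icc 0 T₀, ∫ x, deriv (ρ τ) x * ζ x = -∫ x, ρ τ x * deriv ζ x := by
        intro τ hτ
        rw [integral_mul_deriv_eq_deriv_mul_of_integrable (u := ρ τ) (v := ζ)
          (u' := deriv (ρ τ)) (v' := deriv ζ) (fun x _ => hρd τ hτ x) (fun x _ => hζd hζ x)
          (((hρb.continuous hτ).mul hζ1.continuous).integrable_of_hasCompactSupport hζ1c.mul_left)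
          (((hρb'.continuous hτ).mul hζ.continuous).integrable_of_hasCompactSupport hζc.mul_left)
          (((hρb.continuous hτ).mul hζ.continuous).integrable_of_hasCompactSupport hζc.mul_left),
          neg_neg]
      have hder := (eq_rho (deriv ζ) hζ1 hζ1c t ht).neg
      refine (hder.congr_deriv ?_).congr_of_eventuallyEq
        (Filter.mem_of_superset (Icc_mem_nhds ht.1 ht.2) fun τ hτ => hparts τ hτ)
      have cρ := hρb.continuous htI
      have cρ' := hρb'.continuous htI
      have cb := hbb.continuous htI
      have cbx := hbxb.continuous htI
      have cbxx := hbxxb.continuous htI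
      have i1 : Integrable (fun x => ρ t x * u t x * v t x * deriv (deriv ζ) x) volume :=
        (((cρ.mul (hub.continuous htI)).mul (hvb.continuous htI)).mul
          hζ2.continuous).integrable_of_hasCompactSupport hζ2c.mul_left
      have i2 : Integrable (fun x => deriv (ρ t) x * (bx t x * ζ x + b t x * deriv ζ x)
          + (-1) * (2 * (bx t x * deriv (ρ t) x) + bxx t x * ρ t x) * ζ x) volume := by
        refine Continuous.integrable_of_hasCompactSupport ?_ ?_
        · exact (cρ'.mul ((cbx.mul hζ.continuous).add (cb.mul hζ1.continuous))).add
            ((continuous_const.mul ((continuous_const.mul (cbx.mul cρ')).add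
              (cbxx.mul cρ))).mul hζ.continuous)
        · exact (hζc.mul_left.add hζ1c.mul_left).mul_left.add hζc.mul_left
      -- The two weak forms differ by the integral of the exact derivative of `ρ b ζ' - ρ b_x ζ`, a
      -- compactly supported function.
      have hz : ∫ x, (ρ t x * u t x * v t x * deriv (deriv ζ) x
          + (deriv (ρ t) x * (bx t x * ζ x + b t x * deriv ζ x)
          + (-1) * (2 * (bx t x * deriv (ρ t) x) + bxx t x * ρ t x) * ζ x)) = 0 := by
        refine integral_eq_zero_of_hasDerivAt_of_integrable
          (f := fun x => ρ t x * (b t x * deriv ζ x) - ρ t x * (bx t x * ζ x))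
          (fun x => ?_) (i1.add i2) ?_
        · have d1 := (hρd t htI x).mul ((hbd t htI x).mul (hζd hζ1 x))
          have d2 := (hρd t htI x).mul ((hbxd t htI x).mul (hζd hζ x))
          refine (d1.sub d2).congr_deriv ?_
          simp only [hb, Pi.mul_apply]
          ring
        · exact (Continuous.integrable_of_hasCompactSupport (cρ.mul (cb.mul hζ1.continuous))
            hζ1c.mul_left.mul_left).sub (Continuous.integrable_of_hasCompactSupport
            (cρ.mul (cbx.mul hζ.continuous)) hζc.mul_left.mul_left)
      rw [integral_add i1 i2] at hz
      simp only [hbζ hζ t htI]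
      linarith
    · intro t ht x
      have e1 := hbxb.bound t ht x
      have e2 := hbxxb.bound t ht x
      have e3 : |(-1) * (2 * (bx t x * deriv (ρ t) x) + bxx t x * ρ t x)| ≤
          2 * (P * P + P * P) * |deriv (ρ t) x| +
            ((P * P + P * P) + (P * P + P * P)) * |ρ t x| := by
        rw [abs_mul, abs_neg, abs_one, one_mul]
        refine (abs_add_le _ _).trans (add_le_add ?_ ?_)
        · rw [abs_mul, abs_mul, abs_of_pos (by norm_num : (0 : ℝ) < 2), ← mul_assoc]
          gcongr
        · rw [abs_mul]
          gcongr
      have e4 := mul_le_mul_of_nonneg_right e3 (hφ x).le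
      have e5 : P ^ 2 * (|ρ t x| * logWeight β x) ≤ P ^ 2 * densityConst β P C₀ := by
        have := hrho t ht x
        gcongr
      nlinarith
    · intro x
      have := h0.weighted_rho_x x
      have : 0 ≤ 4 * P ^ 2 * densityConst β P C₀ := by positivity
      linarith
  have hU := weighted_bound_velocity (σ := 1) hβ hT₁ hP (by simp) hu hρb hub hub' hub'' hvb hbb
    hbxb hbd (fun ζ hζ hζc t ht => (eq_m ζ hζ hζc t ht).congr_deriv (by simp only [one_mul, hb]))
    hrho hC₀ h0.weighted_u h0.weighted_u_xx
  have hV := weighted_bound_velocity (σ := -1) hβ hT₁ hP (by simp) hv hρb hvb hvb' hvb'' hub hbb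
    hbxb hbd (fun ζ hζ hζc t ht => (eq_n ζ hζ hζc t ht).congr_deriv
      (by simp only [neg_mul, one_mul, hb, ← sub_eq_add_neg])) hrho hC₀ h0.weighted_v h0.weighted_v_xx
  intro t ht
  have m1 : densityConst β P C₀ ≤ persistenceConst β P C₀ :=
    (le_max_left _ _).trans (le_max_left _ _)
  have m2 : densityDerivConst β P C₀ ≤ persistenceConst β P C₀ :=
    (le_max_right _ _).trans (le_max_left _ _)
  have m3 : 6 * weightConst β ^ 2 * momentumConst β P C₀ ≤ persistenceConst β P C₀ :=
    le_max_right _ _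
  exact ⟨fun x => (hrho t ht x).trans m1, fun x => (hrhox t ht x).trans m2,
    fun x => (hU t ht x).1.trans m3, fun x => (hU t ht x).2.1.trans m3,
    fun x => (hU t ht x).2.2.trans m3, fun x => (hV t ht x).1.trans m3,
    fun x => (hV t ht x).2.1.trans m3, fun x => (hV t ht x).2.2.trans m3⟩

/-! ### From Sobolev and weighted norms to pointwise bounds, and conclusion -/

theorem norm_smul_vec_le_iff {β C : ℝ} (hβ : 0 < β) (hC : 0 ≤ C) (ρ u v : ℝ → ℝ) (x : ℝ) :
    ‖logWeight β x • (![ρ x, deriv ρ x, u x, deriv u x, iteratedDeriv 2 u x,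
      v x, deriv v x, iteratedDeriv 2 v x] : Fin 8 → ℝ)‖ ≤ C ↔
    |ρ x| * logWeight β x ≤ C ∧ |deriv ρ x| * logWeight β x ≤ C ∧ |u x| * logWeight β x ≤ C ∧
    |deriv u x| * logWeight β x ≤ C ∧ |iteratedDeriv 2 u x| * logWeight β x ≤ C ∧
    |v x| * logWeight β x ≤ C ∧ |deriv v x| * logWeight β x ≤ C ∧
    |iteratedDeriv 2 v x| * logWeight β x ≤ C := by
  rw [pi_norm_le_iff_of_nonneg hC]
  simp [Fin.forall_fin_succ, abs_of_pos (logWeight_pos hβ x), mul_comm]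

theorem WeightedBound.weightedNorm_le {β C : ℝ} (hβ : 0 < β) (hC : 0 ≤ C) {ρ u v : ℝ → ℝ}
    (h : WeightedBound β C ρ u v) : weightedNorm β ρ u v ≤ ENNReal.ofReal C := by
  unfold weightedNorm
  rw [eLpNorm_exponent_top]
  refine eLpNormEssSup_le_of_ae_bound (Eventually.of_forall fun x => ?_)
  rw [norm_smul_vec_le_iff hβ hC]
  exact ⟨h.1 x, h.2 x, h.3 x, h.4 x, h.5 x, h.6 x, h.7 x, h.8 x⟩

/-- The essential supremum bounds the weighted vector only almost everywhere. That vector is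
continuous, so the set where the bound holds is closed as well as dense, hence everything. -/
theorem weightedBound_of_weightedNorm_le {β : ℝ} (hβ : 0 < β) {C : ℝ≥0} {ρ u v : ℝ → ℝ}
    (hρ : ContDiff ℝ 1 ρ) (hu : ContDiff ℝ 2 u) (hv : ContDiff ℝ 2 v)
    (h : weightedNorm β ρ u v ≤ C) : WeightedBound β C ρ u v := by
  set V : ℝ → Fin 8 → ℝ := fun x => logWeight β x •
      (![ρ x, deriv ρ x, u x, deriv u x, iteratedDeriv 2 u x,
      v x, deriv v x, iteratedDeriv 2 v x] : Fin 8 → ℝ) with hV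
  have hVc : Continuous V := by
    have c1 := hρ.continuous
    have c2 := hρ.continuous_deriv le_rfl
    have c3 := hu.continuous
    have c4 := hu.continuous_deriv (by norm_num)
    have c5 := hu.continuous_iteratedDeriv 2 le_rfl
    have c6 := hv.continuous
    have c7 := hv.continuous_deriv (by norm_num)
    have c8 := hv.continuous_iteratedDeriv 2 le_rfl
    refine (continuous_logWeight hβ).smul (continuous_pi fun i => ?_)
    fin_cases i <;> assumption
  have hae : ∀ᵐ x ∂(volume : Measure ℝ), ‖V x‖ ≤ C := by
    filter_upwards [ae_le_eLpNormEssSup (f := V) (μ := (volume : Measure ℝ))] with x hx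
    have h1 : ‖V x‖ₑ ≤ C := hx.trans (by rwa [← eLpNorm_exponent_top])
    rw [enorm_le_coe] at h1
    exact_mod_cast h1
  have hall : ∀ x, ‖V x‖ ≤ C := by
    have hd := Measure.dense_of_ae hae
    have hcl : IsClosed {x | ‖V x‖ ≤ C} := isClosed_le hVc.norm continuous_const
    intro x
    have : x ∈ closure {x | ‖V x‖ ≤ C} := hd x
    rwa [hcl.closure_eq] at this
  have := fun x => (norm_smul_vec_le_iff hβ C.coe_nonneg ρ u v x).1 (hall x)
  exact ⟨fun x => (this x).1, fun x => (this x).2.1, fun x => (this x).2.2.1,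
    fun x => (this x).2.2.2.1, fun x => (this x).2.2.2.2.1, fun x => (this x).2.2.2.2.2.1,
    fun x => (this x).2.2.2.2.2.2.1, fun x => (this x).2.2.2.2.2.2.2⟩

/-- Joint continuity and boundedness of the derivatives of a curve in `H^s`. -/
theorem isBddCont_iteratedDeriv {s T₀ : ℝ} {k : ℕ} (hk : (k : ℝ) + 1 / 2 < s) {w : ℝ → ℝ → ℝ}
    {M : ℝ≥0} (hw : ∀ t ∈ Icc 0 T₀, MemH s (w t))
    (hc : ∀ t ∈ Icc 0 T₀,
      Tendsto (fun τ => sobolevNorm s (w τ - w t)) (𝓝[Icc 0 T₀] t) (𝓝 0))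
    (hM : ∀ t ∈ Icc 0 T₀, sobolevNorm s (w t) ≤ M) :
    IsBddCont T₀ ((sobolevConst s k).toReal * M) fun t => iteratedDeriv k (w t) := by
  have hS := (sobolevConst_lt_top hk).ne
  have hcd : ∀ t ∈ Icc 0 T₀, ContDiff ℝ k (w t) := fun t ht =>
    ((hw t ht).contDiff_and_bound hk).1
  refine ⟨?_, fun t ht x => ?_⟩
  · rintro ⟨t, x⟩ ⟨ht, -⟩
    have hlim := ENNReal.Tendsto.const_mul (hc t ht) (Or.inr hS)
    rw [mul_zero] at hlim
    have hfst : Tendsto (fun p : ℝ × ℝ => p.1) (𝓝[Icc 0 T₀ ×ˢ univ] (t, x)) (𝓝[Icc 0 T₀] t) :=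
      tendsto_nhdsWithin_iff.2 ⟨continuousWithinAt_fst.tendsto,
        eventually_mem_nhdsWithin.mono fun p hp => hp.1⟩
    have hsnd : Tendsto (fun p : ℝ × ℝ => edist (iteratedDeriv k (w t) p.2)
        (iteratedDeriv k (w t) x)) (𝓝[Icc 0 T₀ ×ˢ univ] (t, x)) (𝓝 0) := by
      have h1 : Continuous (iteratedDeriv k (w t)) := (hcd t ht).continuous_iteratedDeriv k le_rfl
      exact tendsto_iff_edist_tendsto_0.1
        ((h1.tendsto x).comp continuousWithinAt_snd.tendsto)
    rw [ContinuousWithinAt, tendsto_iff_edist_tendsto_0]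
    have hsum := (hlim.comp hfst).add hsnd
    rw [add_zero] at hsum
    have hfin : ∀ᶠ p : ℝ × ℝ in 𝓝[Icc 0 T₀ ×ˢ univ] (t, x),
        sobolevNorm s (w p.1 - w t) < ⊤ :=
      ((hc t ht).comp hfst).eventually (gt_mem_nhds ENNReal.zero_lt_top)
    refine tendsto_of_tendsto_of_tendsto_of_le_of_le' tendsto_const_nhds hsum
      (Eventually.of_forall fun _ => zero_le) ?_
    filter_upwards [hfin, eventually_mem_nhdsWithin] with p hp hpm
    -- The time increment is small uniformly in space by the embedding applied to `w p.1 - w t`; the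
    -- space increment concerns only the fixed function at time `t`.
    refine (edist_triangle _ (iteratedDeriv k (w t) p.2) _).trans (add_le_add ?_ le_rfl)
    have hd : MemH s (w p.1 - w t) := ⟨(hw _ hpm.1).1.sub (hw t ht).1, hp⟩
    have := (hd.contDiff_and_bound hk).2 p.2
    rw [iteratedDeriv_sub (hcd _ hpm.1).contDiffAt (hcd t ht).contDiffAt] at this
    rw [edist_eq_enorm_sub]
    exact this
  · have h1 := ((hw t ht).contDiff_and_bound hk).2 x
    have h2 : ‖iteratedDeriv k (w t) x‖ₑ ≤ sobolevConst s k * M :=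
      h1.trans (by gcongr; exact hM t ht)
    rw [← Real.norm_eq_abs, ← toReal_enorm]
    have h3 := ENNReal.toReal_mono (ENNReal.mul_ne_top hS ENNReal.coe_ne_top) h2
    simpa using h3

theorem IsBddCont.mono {T₀ P Q : ℝ} {w : ℝ → ℝ → ℝ} (h : IsBddCont T₀ P w) (hPQ : P ≤ Q) :
    IsBddCont T₀ Q w :=
  ⟨h.continuousOn, fun t ht x => (h.bound t ht x).trans hPQ⟩

theorem tripleNorm_le_add (s : ℝ) (ρ u v ρ' u' v' : ℝ → ℝ) :
    tripleNorm s ρ u v ≤ tripleNorm s (ρ - ρ') (u - u') (v - v') + tripleNorm s ρ' u' v' := by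
  have h := fun (r : ℝ) (f g : ℝ → ℝ) => sobolevNorm_add_le r (f - g) g
  simp only [sub_add_cancel] at h
  unfold tripleNorm
  calc _ ≤ (sobolevNorm (s - 1) (ρ - ρ') + sobolevNorm (s - 1) ρ')
        + (sobolevNorm s (u - u') + sobolevNorm s u')
        + (sobolevNorm s (v - v') + sobolevNorm s v') :=
        add_le_add (add_le_add (h _ _ _) (h _ _ _)) (h _ _ _)
    _ = _ := by ring

/-- A common bound for the embedding constants used for `ρ ∈ H^{s-1}` and `u, v ∈ H^s`. -/
noncomputable def embeddingConst (s : ℝ) : ℝ :=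
  (sobolevConst (s - 1) 0).toReal + (sobolevConst (s - 1) 1).toReal + (sobolevConst s 0).toReal
    + (sobolevConst s 1).toReal + (sobolevConst s 2).toReal

/-- On a short time interval, a solution satisfies the weighted estimate, with a constant that
depends only on the bound `M` of the solution. -/
theorem IsSolution.weightedNorm_le {s β T₀ : ℝ} {T : EReal} {ρ₀ u₀ v₀ : ℝ → ℝ}
    {ρ u v : ℝ → ℝ → ℝ} {C₀ M : ℝ≥0} (hs : 5 / 2 < s) (hβ : 0 < β)
    (h : IsSolution s T ρ₀ u₀ v₀ ρ u v) (h₀ : weightedNorm β ρ₀ u₀ v₀ ≤ C₀)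
    (hT₀ : 0 < T₀) (hT₁ : T₀ ≤ 1) (hT : (T₀ : EReal) < T)
    (hM : ∀ t ∈ Icc 0 T₀, tripleNorm s (ρ t) (u t) (v t) ≤ M) :
    ∀ t ∈ Icc 0 T₀, weightedNorm β (ρ t) (u t) (v t) ≤
      ENNReal.ofReal (persistenceConst β (1 + embeddingConst s * M) C₀) := by
  have hI : Icc 0 T₀ ⊆ timeInterval T := fun t ht =>
    ⟨ht.1, (EReal.coe_le_coe_iff.2 ht.2).trans_lt hT⟩
  have hIoo : ∀ t ∈ Ioo 0 T₀, (t : EReal) < T := fun t ht => (hI (Ioo_subset_Icc_self ht)).2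
  have hlim := fun t (ht : t ∈ Icc 0 T₀) =>
    (h.continuous_in_time t (hI ht)).mono_left (nhdsWithin_mono t hI)
  have le1 : ∀ f g k : ℝ → ℝ, sobolevNorm (s - 1) f ≤ tripleNorm s f g k := fun f g k =>
    le_self_add.trans le_self_add
  have le2 : ∀ f g k : ℝ → ℝ, sobolevNorm s g ≤ tripleNorm s f g k := fun f g k =>
    le_add_self.trans le_self_add
  have le3 : ∀ f g k : ℝ → ℝ, sobolevNorm s k ≤ tripleNorm s f g k := fun f g k => le_add_self
  have hsq : ∀ {a : ℝ → ℝ → ℝ≥0∞} {t : ℝ}, t ∈ Icc 0 T₀ →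
      (∀ τ, a τ t ≤ tripleNorm s (ρ τ - ρ t) (u τ - u t) (v τ - v t)) →
      Tendsto (fun τ => a τ t) (𝓝[Icc 0 T₀] t) (𝓝 0) := fun {a t} ht ha =>
    tendsto_of_tendsto_of_tendsto_of_le_of_le tendsto_const_nhds (hlim t ht)
      (fun _ => zero_le) ha
  have hρm := fun t (ht : t ∈ Icc 0 T₀) => h.mem_rho t (hI ht)
  have hum := fun t (ht : t ∈ Icc 0 T₀) => h.mem_u t (hI ht)
  have hvm := fun t (ht : t ∈ Icc 0 T₀) => h.mem_v t (hI ht)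
  have fρ := fun (k : ℕ) (hk : (k : ℝ) + 1 / 2 < s - 1) => isBddCont_iteratedDeriv hk hρm
    (fun t ht => hsq (a := fun τ t => sobolevNorm (s - 1) (ρ τ - ρ t)) ht fun τ => le1 _ _ _)
    (fun t ht => (le1 _ _ _).trans (hM t ht))
  have fu := fun (k : ℕ) (hk : (k : ℝ) + 1 / 2 < s) => isBddCont_iteratedDeriv hk hum
    (fun t ht => hsq (a := fun τ t => sobolevNorm s (u τ - u t)) ht fun τ => le2 _ _ _)
    (fun t ht => (le2 _ _ _).trans (hM t ht))
  have fv := fun (k : ℕ) (hk : (k : ℝ) + 1 / 2 < s) => isBddCont_iteratedDeriv hk hvm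
    (fun t ht => hsq (a := fun τ t => sobolevNorm s (v τ - v t)) ht fun τ => le3 _ _ _)
    (fun t ht => (le3 _ _ _).trans (hM t ht))
  have hE : 0 ≤ embeddingConst s := by unfold embeddingConst; positivity
  have hP : ∀ {c : ℝ}, c ≤ embeddingConst s → c * M ≤ 1 + embeddingConst s * M := fun {c} hc =>
    (mul_le_mul_of_nonneg_right hc M.coe_nonneg).trans (by linarith)
  have Fρ := fun (k : ℕ) (hk : (k : ℝ) + 1 / 2 < s - 1)
    (hc : (sobolevConst (s - 1) k).toReal ≤ embeddingConst s) => (fρ k hk).mono (hP hc)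
  have Fu := fun (k : ℕ) (hk : (k : ℝ) + 1 / 2 < s)
    (hc : (sobolevConst s k).toReal ≤ embeddingConst s) => (fu k hk).mono (hP hc)
  have Fv := fun (k : ℕ) (hk : (k : ℝ) + 1 / 2 < s)
    (hc : (sobolevConst s k).toReal ≤ embeddingConst s) => (fv k hk).mono (hP hc)
  have n0 := ENNReal.toReal_nonneg (a := sobolevConst (s - 1) 0)
  have n1 := ENNReal.toReal_nonneg (a := sobolevConst (s - 1) 1)
  have n2 := ENNReal.toReal_nonneg (a := sobolevConst s 0)
  have n3 := ENNReal.toReal_nonneg (a := sobolevConst s 1)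
  have n4 := ENNReal.toReal_nonneg (a := sobolevConst s 2)
  have cρ : ∀ t ∈ Icc 0 T₀, ContDiff ℝ 1 (ρ t) := fun t ht => by
    have := ((hρm t ht).contDiff_and_bound (k := 1) (by norm_num; linarith)).1
    exact_mod_cast this
  have cu : ∀ t ∈ Icc 0 T₀, ContDiff ℝ 2 (u t) := fun t ht => by
    have := ((hum t ht).contDiff_and_bound (k := 2) (by norm_num; linarith)).1
    exact_mod_cast this
  have cv : ∀ t ∈ Icc 0 T₀, ContDiff ℝ 2 (v t) := fun t ht => by
    have := ((hvm t ht).contDiff_and_bound (k := 2) (by norm_num; linarith)).1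
    exact_mod_cast this
  have h0T : (0 : ℝ) ∈ Icc 0 T₀ := ⟨le_rfl, hT₀.le⟩
  -- The summand `1` in `P` guarantees that the Gronwall rate `4 P²` is at least `1`.
  have hP1 : 1 ≤ 1 + embeddingConst s * M := by
    have := mul_nonneg hE M.coe_nonneg
    linarith
  have key := weightedBound_of_regular (P := 1 + embeddingConst s * M) (C₀ := C₀) hβ hT₁ hP1
    C₀.coe_nonneg cρ cu cv
    (by simpa using Fρ 0 (by norm_num; linarith) (by unfold embeddingConst; linarith))
    (by simpa using Fρ 1 (by norm_num; linarith) (by unfold embeddingConst; linarith))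
    (by simpa using Fu 0 (by norm_num; linarith) (by unfold embeddingConst; linarith))
    (by simpa using Fu 1 (by norm_num; linarith) (by unfold embeddingConst; linarith))
    (Fu 2 (by norm_num; linarith) (by unfold embeddingConst; linarith))
    (by simpa using Fv 0 (by norm_num; linarith) (by unfold embeddingConst; linarith))
    (by simpa using Fv 1 (by norm_num; linarith) (by unfold embeddingConst; linarith))
    (Fv 2 (by norm_num; linarith) (by unfold embeddingConst; linarith))
    (fun ζ hζ hζc t ht => h.eq_rho ζ hζ hζc t ht.1 (hIoo t ht))
    (fun ζ hζ hζc t ht => h.eq_m ζ hζ hζc t ht.1 (hIoo t ht))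
    (fun ζ hζ hζc t ht => h.eq_n ζ hζ hζc t ht.1 (hIoo t ht))
    (weightedBound_of_weightedNorm_le hβ (cρ 0 h0T) (cu 0 h0T) (cv 0 h0T)
      (by rwa [h.initial_rho, h.initial_u, h.initial_v]))
  intro t ht
  refine (key t ht).weightedNorm_le hβ ?_
  exact (mul_nonneg (abs_nonneg _) (logWeight_pos hβ 0).le).trans ((key t ht).weighted_rho 0)

/-- A solution is bounded on a short time interval. -/
theorem IsSolution.exists_bounded_interval {s : ℝ} {T : EReal} {ρ₀ u₀ v₀ : ℝ → ℝ}
    {ρ u v : ℝ → ℝ → ℝ} (hT : 0 < T) (h : IsSolution s T ρ₀ u₀ v₀ ρ u v) :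
    ∃ T₀ : ℝ, 0 < T₀ ∧ T₀ ≤ 1 ∧ (T₀ : EReal) < T ∧
      ∃ M : ℝ≥0, ∀ t ∈ Icc 0 T₀, tripleNorm s (ρ t) (u t) (v t) ≤ M := by
  obtain ⟨a, ha0, haT⟩ := EReal.lt_iff_exists_real_btwn.1 hT
  have ha : 0 < a := by exact_mod_cast ha0
  have h0 : (0 : ℝ) ∈ timeInterval T := ⟨le_rfl, by exact_mod_cast hT⟩
  have hev := (h.continuous_in_time 0 h0).eventually (gt_mem_nhds one_pos)
  rw [eventually_nhdsWithin_iff, Metric.eventually_nhds_iff] at hev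
  obtain ⟨δ, hδ, hball⟩ := hev
  -- `a` keeps the interval below `T`, the cap `1` frees the later constants from `T₀`, and halving
  -- `δ` puts the closed interval inside the open ball.
  set T₀ := min (min a 1) (δ / 2) with hT₀
  have hT₀a : T₀ ≤ a := (min_le_left _ _).trans (min_le_left _ _)
  have hT₀T : (T₀ : EReal) < T := (EReal.coe_le_coe_iff.2 hT₀a).trans_lt haT
  have hfin : tripleNorm s (ρ 0) (u 0) (v 0) < ⊤ :=
    ENNReal.add_lt_top.2 ⟨ENNReal.add_lt_top.2 ⟨(h.mem_rho 0 h0).2, (h.mem_u 0 h0).2⟩,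
      (h.mem_v 0 h0).2⟩
  refine ⟨T₀, by positivity, (min_le_left _ _).trans (min_le_right _ _), hT₀T,
    1 + (tripleNorm s (ρ 0) (u 0) (v 0)).toNNReal, fun t ht => ?_⟩
  have ht2 : t ≤ δ / 2 := ht.2.trans (min_le_right _ _)
  have h1 := hball (y := t) (by rw [Real.dist_eq, sub_zero, abs_of_nonneg ht.1]; linarith)
    ⟨ht.1, (EReal.coe_le_coe_iff.2 ht.2).trans_lt hT₀T⟩
  refine (tripleNorm_le_add s _ _ _ (ρ 0) (u 0) (v 0)).trans ?_
  rw [ENNReal.coe_add, ENNReal.coe_toNNReal hfin.ne]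
  exact add_le_add h1.le le_rfl

end DP3

theorem theorem1p6 (s : ℝ) (hs : 5 / 2 < s) (β : ℝ) (hβ : 0 < β) :
    ∃ C₁ : ℝ≥0 → ℝ≥0 → ℝ≥0,
      ∀ (T : EReal) (ρ₀ u₀ v₀ : ℝ → ℝ) (ρ u v : ℝ → ℝ → ℝ) (C₀ : ℝ≥0),
        0 < T →
        DP3.IsSolution s T ρ₀ u₀ v₀ ρ u v →
        DP3.weightedNorm β ρ₀ u₀ v₀ ≤ C₀ →
        ∃ T₀ : ℝ, 0 < T₀ ∧ (T₀ : EReal) < T ∧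
          (∃ M : ℝ≥0, ∀ t ∈ Set.Icc 0 T₀, DP3.tripleNorm s (ρ t) (u t) (v t) ≤ M) ∧
          ∀ M : ℝ≥0, (∀ t ∈ Set.Icc 0 T₀, DP3.tripleNorm s (ρ t) (u t) (v t) ≤ M) →
            ∀ t ∈ Set.Icc 0 T₀, DP3.weightedNorm β (ρ t) (u t) (v t) ≤ C₁ M C₀ := by
  -- `T₀` is fixed before `M`: the persistence estimate holds on any interval of length at most `1`
  -- inside the lifespan, for every bound `M` valid there.
  refine ⟨fun M C₀ => (DP3.persistenceConst β (1 + DP3.embeddingConst s * M) C₀).toNNReal,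
    fun T ρ₀ u₀ v₀ ρ u v C₀ hT h h₀ => ?_⟩
  obtain ⟨T₀, hT₀, hT₁, hT₀T, hM⟩ := h.exists_bounded_interval hT
  exact ⟨T₀, hT₀, hT₀T, hM, fun M hM t ht => h.weightedNorm_le hs hβ h₀ hT₀ hT₁ hT₀T hM t ht⟩
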